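/- Let $K$ be a field, let $E=K\langle e_1,\dots,e_5\rangle$ be the exterior algebra in five variables, and let $$J=(e_1\wedge e_2,\; e_1\wedge e_3,\; e_1\wedge e_4,\; e_1\wedge e_5,\; e_2\wedge e_3\wedge e_4)\subset E .$$ Notation (for a graded ideal $J$ of the exterior algebra $E=K\langle e_1,\dots,e_n\rangle$ containing no nonzero linear form, and $A=E/J$). The first resonance variety $R^1(A)$ is the set of all $u\in A_1=E_1=K^n$ such that the complex $0\to A_0\xrightarrow{\cdot u}A_1\xrightarrow{\cdot u}A_2\to\cdots$ has nonzero cohomology in degree $1$. The number $h_r$ counts the irreducible components of $R^1(A)$ (in the Zariski topology of $K^n$) of dimension $r$. The algebra $A$ has property (*) if any two distinct irreducible components of $R^1(A)$ meet only at $0$, and $u\wedge v\in J$ whenever $u,v$ lie in the same irreducible component of $R^1(A)$. The graded Betti numbers of a graded $E$-module $M$ are $\beta^E_{i,j}(M)=\dim_K \operatorname{Tor}^E_i(K,M)_j$. An ideal is pure if it is generated by products of linear forms. A monomial ideal $J$ is strongly stable if for each monomial $e_F\in J$, each $i\in F$ and each $j<i$ one has $e_j\wedge e_{F\setminus\{i\}}\in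 J$. Conjecture B asserts that if $J$ is pure (nonzero and containing no nonzero linear form) and $E/J$ has property (*), then for $i\gg 0$ $$\beta^E_{i,i+1}(E/J)= i\sum_{r\ge 1}h_r\binom{r+i-1}{i+1}.$$ Then for the above ideal $J$ in five variables: 1. $J$ is a strongly stable monomial ideal; in particular it is pure. 2. $R^1(E/J)=\operatorname{span}_K\{e_1,\dots,e_5\}=K^5$. 3. For all $i\ge 0$, $$\beta^E_{i+1,i+2}(E/J)=\beta^E_{i,i+2}(J)=\binom{i+1}{1}+\binom{i+2}{2}+\binom{i+3}{3}+\binom{i+4}{4}<(i+1)\binom{i+5}{i+2}.$$ 4. If $K$ is infinite, then $R^1(E/J)$ is irreducible, $E/J$ does not have property (*), and for all $i\ge 0$ $$\beta^E_{i+1,i+2}(E/J)<(i+1)\binom{i+5}{i+2}=(i+1)\sum_{r\ge 1}h_r\binom{r+i}{i+2}.$$ In particular, the formula of Conjecture B does not hold for $E/J$ for $i\gg 0$, and over any infinite field $K$ the statement obtained from Conjecture B by omitting property (*) is false. -/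

import Mathlib

noncomputable section

/-- The exterior algebra `E = K⟨e_1, …, e_n⟩`; the variables are indexed by `Fin n`. -/
abbrev ExtAlg (K : Type*) [Field K] (n : ℕ) : Type _ := ExteriorAlgebra K (Fin n → K)

namespace ExtAlg

variable {K : Type*} [Field K] {n : ℕ}

/-- The linear form `α_1 e_1 + ⋯ + α_n e_n` with coordinate vector `α`.  This identifies the affine
space `K^n` with `E_1`. -/
def linForm (α : Fin n → K) : ExtAlg K n := ExteriorAlgebra.ι K α

/-- The variable `e_{k+1}`. -/
def e (K : Type*) [Field K] {n : ℕ} (k : Fin n) : ExtAlg K n := linForm (Pi.single k 1)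

/-- The monomial `e_F = e_{i_1} ∧ ⋯ ∧ e_{i_t}` for `F = {i_1 < ⋯ < i_t}`. -/
def mono (K : Type*) [Field K] {n : ℕ} (F : Finset (Fin n)) : ExtAlg K n :=
  ((F.sort (· ≤ ·)).map (e K)).prod

/-- The homogeneous component `E_k` for an integer `k`; it is zero for `k < 0`. -/
def gr (K : Type*) [Field K] (n : ℕ) (k : ℤ) : Submodule K (ExtAlg K n) :=
  if 0 ≤ k then ⋀[K]^k.toNat (Fin n → K) else ⊥

/-! ### Monomial ideals and pure ideals -/

/-- Monomial ideals. -/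
def IsMonomial (J : TwoSidedIdeal (ExtAlg K n)) : Prop :=
  ∃ S : Set (Finset (Fin n)), J = TwoSidedIdeal.span (mono K '' S)

/-- Strongly stable monomial ideals: `e_j (u / e_i) ∈ J` for every monomial `u = e_F ∈ J`,
every `i ∈ F` and every `j < i`.  (Up to sign, `u / e_i` is `e_{F \ {i}}`.) -/
def IsStronglyStable (J : TwoSidedIdeal (ExtAlg K n)) : Prop :=
  IsMonomial J ∧ ∀ F : Finset (Fin n), mono K F ∈ J →
    ∀ i ∈ F, ∀ j, j < i → e K j * mono K (F.erase i) ∈ J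

/-- Pure ideals: ideals generated by products of linear forms. -/
def IsPure (J : TwoSidedIdeal (ExtAlg K n)) : Prop :=
  ∃ S : Set (List (Fin n → K)), (∀ l ∈ S, l ≠ []) ∧
    J = TwoSidedIdeal.span ((fun l : List (Fin n → K) => (l.map linForm).prod) '' S)

/-! ### The algebra `A = E/J` and its resonance varieties -/

/-- The algebra `A = E/J`. -/
abbrev Quot (J : TwoSidedIdeal (ExtAlg K n)) : Type _ := ExtAlg K n ⧸ J.asIdeal

/-- The graded piece `A_k` of `A = E/J`, the image of `E_k`. -/
def quotGr (J : TwoSidedIdeal (ExtAlg K n)) (k : ℤ) : Submodule K (Quot J) :=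
  (gr K n k).map (Ideal.Quotient.mkₐ K J.asIdeal).toLinearMap

/-- The grading of `J`, viewed as an `E`-module: `J_k = J ∩ E_k`. -/
def idealGr (J : TwoSidedIdeal (ExtAlg K n)) (k : ℤ) : Submodule K J.asIdeal :=
  (gr K n k).comap (J.asIdeal.subtype.restrictScalars K)

/-- Multiplication `a ↦ a · u` of `A = E/J` by the class `u` of the linear form `α`. -/
def mulBy (J : TwoSidedIdeal (ExtAlg K n)) (α : Fin n → K) : Quot J →ₗ[K] Quot J :=
  LinearMap.mulRight K (Ideal.Quotient.mkₐ K J.asIdeal (linForm α))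

/-- The `p`-cocycles of the complex `0 → A_0 → A_1 → A_2 → ⋯` with differential `a ↦ a · u`. -/
def cocycles (J : TwoSidedIdeal (ExtAlg K n)) (α : Fin n → K) (p : ℕ) : Submodule K (Quot J) :=
  quotGr J p ⊓ LinearMap.ker (mulBy J α)

/-- The `p`-coboundaries of that complex. -/
def coboundaries (J : TwoSidedIdeal (ExtAlg K n)) (α : Fin n → K) : ℕ → Submodule K (Quot J)
  | 0 => ⊥
  | p + 1 => (quotGr J p).map (mulBy J α)

/-- The cohomology `H^p(A, u)`. -/
abbrev cohomology (J : TwoSidedIdeal (ExtAlg K n)) (α : Fin n → K) (p : ℕ) : Type _ :=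
  cocycles J α p ⧸ (coboundaries J α p).submoduleOf (cocycles J α p)

/-- The resonance variety `R^p(E/J)`, the set of all `u` with `H^p(A, u) ≠ 0`, as a subset of
the affine space `K^n = E_1`.  (For `J` without linear forms, `A_1 = E_1`.) -/
def resonance (J : TwoSidedIdeal (ExtAlg K n)) (p : ℕ) : Set (Fin n → K) :=
  {α | Nontrivial (cohomology J α p)}

/-! ### Irreducible components and dimension in the affine space `K^n` -/

/-- The Zariski topology of `K^n`: the sets `{α | f α ≠ 0}`, for `f` a polynomial, form a basis. -/
@[reducible] def zariski (K : Type*) [Field K] (n : ℕ) : TopologicalSpace (Fin n → K) :=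
  TopologicalSpace.generateFrom
    {U | ∃ f : MvPolynomial (Fin n) K, U = {α | MvPolynomial.eval α f ≠ 0}}

/-- `Z ⊆ K^n` is (non-empty and) irreducible in the Zariski topology. -/
def ZariskiIrreducible (Z : Set (Fin n → K)) : Prop := @IsIrreducible _ (zariski K n) Z

/-- The irreducible components of a subset `R` of `K^n`: its maximal irreducible subsets. -/
def components (R : Set (Fin n → K)) : Set (Set (Fin n → K)) :=
  {Z | Maximal (fun T => T ⊆ R ∧ ZariskiIrreducible T) Z}

/-- The dimension of `Z ⊆ K^n`: the Krull dimension of the coordinate ring `K[x_1, …, x_n]/I(Z)`. -/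
def zdim (Z : Set (Fin n → K)) : WithBot ℕ∞ :=
  ringKrullDim (MvPolynomial (Fin n) K ⧸ MvPolynomial.vanishingIdeal K Z)

/-- `h_r`, the number of `r`-dimensional components of `R^1(E/J)` in `K^n`. -/
def numComponents (J : TwoSidedIdeal (ExtAlg K n)) (r : ℕ) : ℕ :=
  {Z ∈ components (resonance J 1) | zdim Z = (r : WithBot ℕ∞)}.ncard

/-- Property (*): two distinct irreducible components of `R^1(E/J)` meet at most in `0`, and
`u ∧ v ∈ J` whenever `u`, `v` lie in one irreducible component of `R^1(E/J)`. -/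
def PropertyStar (J : TwoSidedIdeal (ExtAlg K n)) : Prop :=
  (∀ Z₁ ∈ components (resonance J 1), ∀ Z₂ ∈ components (resonance J 1),
      Z₁ ≠ Z₂ → Z₁ ∩ Z₂ ⊆ {0}) ∧
    ∀ Z ∈ components (resonance J 1), ∀ u ∈ Z, ∀ v ∈ Z, linForm u * linForm v ∈ J

/-! ### Graded free resolutions, Tor and graded Betti numbers -/

/-- A resolution `⋯ → F_1 → F_0 → M → 0` of a graded left `E`-module `M` (with homogeneous
components `𝓜 k`) by graded free `E`-modules of finite rank, with homogeneous maps of degree `0`: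
`F_i = E^(rank i)`, and its `b`-th standard basis vector has degree `deg i b`. -/
structure GradedFreeResolution (n : ℕ) {M : Type*} [AddCommGroup M] [Module K M]
    [Module (ExtAlg K n) M] [IsScalarTower K (ExtAlg K n) M] (𝓜 : ℤ → Submodule K M) where
  /-- the rank of `F_i` -/
  rank : ℕ → ℕ
  /-- the degrees of the basis vectors of `F_i` -/
  deg : ∀ i, Fin (rank i) → ℤ
  /-- the differential `F_{i+1} → F_i` -/
  d : ∀ i, (Fin (rank (i + 1)) → ExtAlg K n) →ₗ[ExtAlg K n] (Fin (rank i) → ExtAlg K n)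
  /-- the augmentation `F_0 → M` -/
  aug : (Fin (rank 0) → ExtAlg K n) →ₗ[ExtAlg K n] M
  d_homogeneous : ∀ i b b', d i (Pi.single b 1) b' ∈ gr K n (deg (i + 1) b - deg i b')
  aug_homogeneous : ∀ b, aug (Pi.single b 1) ∈ 𝓜 (deg 0 b)
  aug_surjective : Function.Surjective aug
  exact_zero : Function.Exact (d 0) aug
  exact_succ : ∀ i, Function.Exact (d (i + 1)) (d i)

namespace GradedFreeResolution

variable {M : Type*} [AddCommGroup M] [Module K M] [Module (ExtAlg K n) M]
  [IsScalarTower K (ExtAlg K n) M] {𝓜 : ℤ → Submodule K M} (F : GradedFreeResolution n 𝓜)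

/-- The degree `j` part of `K ⊗_E F_i = K^(rank i)`: it is spanned by the basis vectors of
degree `j`. -/
def tensorGr (i : ℕ) (j : ℤ) : Submodule K (Fin (F.rank i) → K) where
  carrier := {x | ∀ b, F.deg i b ≠ j → x b = 0}
  add_mem' := fun {x y} hx hy b hb => by simp [hx b hb, hy b hb]
  zero_mem' := fun _ _ => rfl
  smul_mem' := fun c x hx b hb => by simp [hx b hb]

/-- The differential of `K ⊗_E F`, where `K = E/(e_1, …, e_n)`.  Its matrix is obtained from that
of `d` by applying the augmentation `E → K` to the entries. -/
def tensorD (i : ℕ) : (Fin (F.rank (i + 1)) → K) →ₗ[K] (Fin (F.rank i) → K) :=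
  (ExteriorAlgebra.algebraMapInv (R := K) (M := Fin n → K)).toLinearMap.compLeft (Fin (F.rank i))
    ∘ₗ (F.d i).restrictScalars K
    ∘ₗ (Algebra.linearMap K (ExtAlg K n)).compLeft (Fin (F.rank (i + 1)))

/-- The cycles of `K ⊗_E F` in homological degree `i` and internal degree `j`. -/
def cycles : ∀ (i : ℕ) (_ : ℤ), Submodule K (Fin (F.rank i) → K)
  | 0, j => F.tensorGr 0 j
  | i + 1, j => F.tensorGr (i + 1) j ⊓ LinearMap.ker (F.tensorD i)

/-- The boundaries of `K ⊗_E F` in homological degree `i` and internal degree `j`. -/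
def boundaries (i : ℕ) (j : ℤ) : Submodule K (Fin (F.rank i) → K) :=
  (F.tensorGr (i + 1) j).map (F.tensorD i)

/-- `Tor_i^E(K, M)_j = H_i(K ⊗_E F)_j`. -/
abbrev Tor (i : ℕ) (j : ℤ) : Type _ :=
  F.cycles i j ⧸ (F.boundaries i j).submoduleOf (F.cycles i j)

end GradedFreeResolution

open Classical in
/-- The graded Betti number `β_{i,j}^E(M) = dim_K Tor_i^E(K, M)_j`, computed with some graded free
resolution of `M`.  Every finitely generated graded module has one, and the dimension
does not depend on it; the value `0` in the other case is a convention. -/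
def gradedBetti (n : ℕ) {M : Type*} [AddCommGroup M] [Module K M] [Module (ExtAlg K n) M]
    [IsScalarTower K (ExtAlg K n) M] (𝓜 : ℤ → Submodule K M) (i : ℕ) (j : ℤ) : ℕ :=
  if h : Nonempty (GradedFreeResolution n 𝓜) then Module.finrank K (h.some.Tor i j) else 0

/-- `β_{i,j}^E(E/J)`. -/
def bettiQuot (J : TwoSidedIdeal (ExtAlg K n)) (i : ℕ) (j : ℤ) : ℕ := gradedBetti n (quotGr J) i j

/-- `β_{i,j}^E(J)`. -/
def bettiIdeal (J : TwoSidedIdeal (ExtAlg K n)) (i : ℕ) (j : ℤ) : ℕ := gradedBetti n (idealGr J) i j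

/-! ### The conjectured formula -/

/-- The conjectured value `i ∑_{r ≥ 1} h_r binom(r+i-1, i+1)` of `β_{i,i+1}^E(E/J)`.  All
components of `R^1(E/J)` lie in `K^n`, so `h_r = 0` for `r > n`. -/
def conjecturedBetti (J : TwoSidedIdeal (ExtAlg K n)) (i : ℕ) : ℕ :=
  i * ∑ r ∈ Finset.Icc 1 n, numComponents J r * (r + i - 1).choose (i + 1)

/-- The formula `β_{i,i+1}^E(E/J) = i ∑_{r ≥ 1} h_r binom(r+i-1, i+1)` holds for `i ≫ 0`. -/
def LinearStrandFormula (J : TwoSidedIdeal (ExtAlg K n)) : Prop :=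
  ∀ᶠ i : ℕ in Filter.atTop, bettiQuot J i (i + 1) = conjecturedBetti J i

/-- Conjecture B over `K`, with the hypothesis "`E/J` has property (*)" left out.  As usual, `J` is
non-zero and contains no linear form. -/
def ConjectureBWithoutStar (K : Type*) [Field K] : Prop :=
  ∀ (n : ℕ) (J : TwoSidedIdeal (ExtAlg K n)), J ≠ ⊥ → (∀ α : Fin n → K, linForm α ∈ J → α = 0) →
    IsPure J → LinearStrandFormula J

/-- The ideal `(e_1e_2, e_1e_3, e_1e_4, e_1e_5, e_2e_3e_4)` in five variables. -/
def exampleIdeal (K : Type*) [Field K] : TwoSidedIdeal (ExtAlg K 5) :=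
  TwoSidedIdeal.span
    {e K 0 * e K 1, e K 0 * e K 2, e K 0 * e K 3, e K 0 * e K 4, e K 1 * e K 2 * e K 3}

end ExtAlg

end

noncomputable section

namespace ExtAlg

set_option linter.unusedSectionVars false

universe u

variable {K : Type u} [Field K] {n : ℕ}

/-! ### The grading of `E` -/

/-! Everything rests on the degree 2 part of `J`, which is `e_1 ∧ E_1`; the cubic generator does not
reach it, and `J` vanishes in lower degrees.

Betti numbers. `gradedBetti` is defined through an arbitrarily chosen resolution, so it is first
made computable: `Tor_i(K, M)_j` has the dimension of the Cartan homology of `M`, whose chains are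
elements `∑ f(a) x^(a)` of `M` tensored with divided powers, with differential `x^(a) ↦ ∑ e_k x^(a -
ε_k)`. This complex is acyclic in positive degrees on graded free modules (`exists_eq_bd`).
Dimension shifting along a resolution (`GradedFreeResolution.finrank_tor`) then gives the
comparison, and with it independence of the resolution. Existence of resolutions follows from finite
dimensionality, and splicing a resolution of `J` with `E → E/J` shifts the Betti numbers by one.

The linear strand. For `M = J`, homological degree `i` and internal degree `i + 2`, boundaries
vanish because they come from chains with values in `J_1 = 0`. A cycle has the form `a ↦ e_1 ∧ v(a)`
with `v(a)` defined modulo `e_1`, and the cycle condition says `v(a + ε_k)_l = v(a + ε_l)_k` for `k,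
l` different from the first index. Hence `v(a)_k = h(a + ε_k)` for a unique function `h` on the
monomials of degree `i + 1` in five variables other than the power of the first one
(`exists_strandCycle_eq`, `strandCycle_injective`). Their number is `binom(i+5, 4) - 1`, which
Pascal's rule turns into the stated sum.

Resonance. Since `e_1 ∧ v ∈ J` for all `v`, every `u` is annihilated in `E/J` by a linear form not
proportional to it, so `R^1 = K^5`. Over an infinite field this is irreducible of dimension 5, so
`h_5 = 1` is the only contribution and the predicted value is `(i+1) binom(i+5, i+2)`, which is at
least `binom(i+5, 4)` and so too large. Property (*) fails because `e_2 ∧ e_3 ∉ J`. -/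

theorem gr_natCast (k : ℕ) : gr K n (k : ℤ) = ⋀[K]^k (Fin n → K) := by
  simp [gr]

theorem gr_of_neg {k : ℤ} (hk : k < 0) : gr K n k = ⊥ := by
  simp [gr, hk]

theorem gr_of_lt {k : ℤ} (hk : n < k) : gr K n k = ⊥ := by
  lift k to ℕ using by omega
  rw [gr_natCast, ← Submodule.finrank_eq_zero (R := K), exteriorPower.finrank_eq, Module.finrank_fin_fun]
  exact Nat.choose_eq_zero_of_lt (by exact_mod_cast hk)

theorem mul_mem_gr {i j : ℤ} {a b : ExtAlg K n} (ha : a ∈ gr K n i) (hb : b ∈ gr K n j) :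
    a * b ∈ gr K n (i + j) := by
  rcases lt_or_ge i 0 with hi | hi
  · rw [gr_of_neg hi, Submodule.mem_bot] at ha
    simp [ha]
  rcases lt_or_ge j 0 with hj | hj
  · rw [gr_of_neg hj, Submodule.mem_bot] at hb
    simp [hb]
  lift i to ℕ using hi
  lift j to ℕ using hj
  rw [← Nat.cast_add]
  rw [gr_natCast] at *
  exact SetLike.GradedMul.mul_mem ha hb

theorem algebraMap_mem_gr (c : K) : algebraMap K (ExtAlg K n) c ∈ gr K n 0 := by
  have := gr_natCast (K := K) (n := n) 0
  rw [Nat.cast_zero] at this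
  rw [this]
  exact SetLike.algebraMap_mem_graded (fun i : ℕ => ⋀[K]^i (Fin n → K)) c

theorem linForm_mem_gr (v : Fin n → K) : linForm v ∈ gr K n 1 := by
  have := gr_natCast (K := K) (n := n) 1
  rw [Nat.cast_one] at this
  rw [this, ExteriorAlgebra.exteriorPower, pow_one]
  exact ⟨v, rfl⟩

theorem e_mem_gr (k : Fin n) : e K k ∈ gr K n 1 := linForm_mem_gr _

theorem mem_gr_zero {x : ExtAlg K n} (hx : x ∈ gr K n 0) : ∃ c, x = algebraMap K _ c := by
  have := gr_natCast (K := K) (n := n) 0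
  rw [Nat.cast_zero] at this
  rw [this, ExteriorAlgebra.exteriorPower, pow_zero] at hx
  obtain ⟨c, hc⟩ := Submodule.mem_one.1 hx
  exact ⟨c, hc.symm⟩

theorem linForm_eq_sum (v : Fin n → K) : linForm v = ∑ k, v k • e K k := by
  conv_lhs => rw [pi_eq_sum_univ' v]
  simp only [linForm, e, map_sum, map_smul]

/-- The projection of `E` onto `E_k`. -/
def gproj (K : Type*) [Field K] (n : ℕ) (k : ℤ) : ExtAlg K n →ₗ[K] ExtAlg K n :=
  if 0 ≤ k then GradedAlgebra.proj (fun i : ℕ => ⋀[K]^i (Fin n → K)) k.toNat else 0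

theorem gproj_mem (k : ℤ) (x : ExtAlg K n) : gproj K n k x ∈ gr K n k := by
  rcases lt_or_ge k 0 with hk | hk
  · simp [gproj, not_le.2 hk]
  · lift k to ℕ using hk
    simp only [gproj, gr_natCast, Nat.cast_nonneg, if_true, Int.toNat_natCast]
    exact SetLike.coe_mem (DirectSum.decompose (fun i : ℕ => ⋀[K]^i (Fin n → K)) x k)

theorem gproj_of_mem {k : ℤ} {x : ExtAlg K n} (hx : x ∈ gr K n k) : gproj K n k x = x := by
  rcases lt_or_ge k 0 with hk | hk
  · rw [gr_of_neg hk, Submodule.mem_bot] at hx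
    simp [hx]
  · lift k to ℕ using hk
    rw [gr_natCast] at hx
    simp only [gproj, Nat.cast_nonneg, if_true, Int.toNat_natCast, GradedAlgebra.proj_apply]
    exact DirectSum.decompose_of_mem_same _ hx

theorem gproj_of_mem_ne {k j : ℤ} {x : ExtAlg K n} (hx : x ∈ gr K n k) (h : j ≠ k) :
    gproj K n j x = 0 := by
  rcases lt_or_ge k 0 with hk | hk
  · rw [gr_of_neg hk, Submodule.mem_bot] at hx
    simp [hx]
  rcases lt_or_ge j 0 with hj | hj
  · simp [gproj, not_le.2 hj]
  lift k to ℕ using hk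
  lift j to ℕ using hj
  rw [gr_natCast] at hx
  simp only [gproj, Nat.cast_nonneg, if_true, Int.toNat_natCast, GradedAlgebra.proj_apply]
  exact DirectSum.decompose_of_mem_ne _ hx (by exact_mod_cast h.symm)

theorem gr_induction {C : ExtAlg K n → Prop} (mem : ∀ (j : ℤ) (x), x ∈ gr K n j → C x)
    (add : ∀ x y, C x → C y → C (x + y)) (x : ExtAlg K n) : C x := by
  classical
  rw [← DirectSum.sum_support_decompose (fun i : ℕ => ⋀[K]^i (Fin n → K)) x]
  refine Finset.sum_induction _ C add (mem 0 0 (zero_mem _)) fun i _ => mem i _ ?_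
  rw [gr_natCast]
  exact SetLike.coe_mem _

theorem gproj_mul_left {i : ℤ} {a : ExtAlg K n} (ha : a ∈ gr K n i) (j : ℤ) (x : ExtAlg K n) :
    gproj K n j (a * x) = a * gproj K n (j - i) x := by
  induction x using gr_induction with
  | mem k x hx =>
    by_cases h : j = i + k
    · subst h
      rw [gproj_of_mem (mul_mem_gr ha hx), add_sub_cancel_left, gproj_of_mem hx]
    · rw [gproj_of_mem_ne (mul_mem_gr ha hx) h, gproj_of_mem_ne hx (by omega), mul_zero]
  | add x y hx hy => rw [mul_add, map_add, hx, hy, map_add, mul_add]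

theorem gproj_mul_right {i : ℤ} {a : ExtAlg K n} (ha : a ∈ gr K n i) (j : ℤ) (x : ExtAlg K n) :
    gproj K n j (x * a) = gproj K n (j - i) x * a := by
  induction x using gr_induction with
  | mem k x hx =>
    by_cases h : j = k + i
    · subst h
      rw [gproj_of_mem (mul_mem_gr hx ha), add_sub_cancel_right, gproj_of_mem hx]
    · rw [gproj_of_mem_ne (mul_mem_gr hx ha) h, gproj_of_mem_ne hx (by omega), zero_mul]
  | add x y hx hy => rw [add_mul, map_add, hx, hy, map_add, add_mul]

/-- The shift `c` plays the role of the degree of a basis vector, so that one finite set of degrees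
can serve all coordinates of a graded free module. -/
theorem sum_gproj (s : Finset ℤ) (c : ℤ) (hs : ∀ m : ℕ, m ≤ n → m + c ∈ s) (x : ExtAlg K n) :
    ∑ k ∈ s, gproj K n (k - c) x = x := by
  induction x using gr_induction with
  | mem j x hx =>
    rcases lt_or_ge j 0 with hj | hj
    · rw [gr_of_neg hj, Submodule.mem_bot] at hx
      simp [hx]
    rcases lt_or_ge (n : ℤ) j with hj' | hj'
    · rw [gr_of_lt hj', Submodule.mem_bot] at hx
      simp [hx]
    lift j to ℕ using hj
    rw [Finset.sum_eq_single_of_mem _ (hs j (by exact_mod_cast hj')), add_sub_cancel_right,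
      gproj_of_mem hx]
    intro k _ hk
    exact gproj_of_mem_ne hx (by omega)
  | add x y hx hy => simp only [map_add, Finset.sum_add_distrib, hx, hy]

instance : Module.Finite K (ExtAlg K n) :=
  Module.Finite.of_basis (Pi.basisFun K (Fin n)).ExteriorAlgebra

/-! ### The augmentation and the contractions -/

theorem algebraMapInv_linForm (v : Fin n → K) :
    ExteriorAlgebra.algebraMapInv (linForm v) = (0 : K) := by
  simp [linForm, ExteriorAlgebra.algebraMapInv]

theorem exists_eq_sum_e_mul {j : ℤ} (hj : j ≠ 0) {x : ExtAlg K n} (hx : x ∈ gr K n j) :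
    ∃ y : Fin n → ExtAlg K n, (∀ k, y k ∈ gr K n (j - 1)) ∧ x = ∑ k, e K k * y k := by
  rcases lt_or_ge j 0 with h | h
  · rw [gr_of_neg h, Submodule.mem_bot] at hx
    exact ⟨0, fun k => zero_mem _, by simp [hx]⟩
  lift j to ℕ using h
  obtain ⟨m, rfl⟩ := Nat.exists_eq_succ_of_ne_zero (Nat.cast_ne_zero.1 hj)
  rw [gr_natCast, ExteriorAlgebra.exteriorPower, pow_succ'] at hx
  have hm : ((m.succ : ℕ) : ℤ) - 1 = m := by simp
  rw [hm]
  induction hx using Submodule.mul_induction_on' with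
  | mem_mul_mem u hu w hw =>
    obtain ⟨v, rfl⟩ := hu
    refine ⟨fun k => v k • w, fun k => Submodule.smul_mem _ _ (by rwa [gr_natCast]), ?_⟩
    change linForm v * w = _
    rw [linForm_eq_sum, Finset.sum_mul]
    simp
  | add x _ y _ hx hy =>
    obtain ⟨u, hu, rfl⟩ := hx
    obtain ⟨w, hw, rfl⟩ := hy
    exact ⟨u + w, fun k => add_mem (hu k) (hw k), by simp [mul_add, Finset.sum_add_distrib]⟩

theorem algebraMapInv_of_mem {j : ℤ} (hj : j ≠ 0) {x : ExtAlg K n} (hx : x ∈ gr K n j) :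
    ExteriorAlgebra.algebraMapInv x = (0 : K) := by
  obtain ⟨y, -, rfl⟩ := exists_eq_sum_e_mul hj hx
  simp [e, algebraMapInv_linForm]

theorem algebraMapInv_algebraMap (c : K) :
    ExteriorAlgebra.algebraMapInv (algebraMap K (ExtAlg K n) c) = c :=
  ExteriorAlgebra.algebraMap_leftInverse _ c

theorem exists_eq_sum_e_mul_of_algebraMapInv {j : ℤ} {x : ExtAlg K n} (hx : x ∈ gr K n j)
    (h : ExteriorAlgebra.algebraMapInv x = (0 : K)) :
    ∃ y : Fin n → ExtAlg K n, (∀ k, y k ∈ gr K n (j - 1)) ∧ x = ∑ k, e K k * y k := by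
  by_cases hj : j = 0
  · subst hj
    obtain ⟨c, rfl⟩ := mem_gr_zero hx
    rw [algebraMapInv_algebraMap] at h
    exact ⟨0, fun k => zero_mem _, by simp [h]⟩
  · exact exists_eq_sum_e_mul hj hx

/-- The contraction with the `k`-th coordinate function. -/
def contr (k : Fin n) : ExtAlg K n →ₗ[K] ExtAlg K n :=
  CliffordAlgebra.contractLeft (LinearMap.proj k : (Fin n → K) →ₗ[K] K)

theorem contr_linForm_mul (k : Fin n) (v : Fin n → K) (x : ExtAlg K n) :
    contr k (linForm v * x) = v k • x - linForm v * contr k x :=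
  CliffordAlgebra.contractLeft_ι_mul _ _ _

theorem contr_linForm (k : Fin n) (v : Fin n → K) :
    contr k (linForm v) = algebraMap K (ExtAlg K n) (v k) :=
  CliffordAlgebra.contractLeft_ι _ _ _

theorem contr_algebraMap (k : Fin n) (c : K) : contr k (algebraMap K (ExtAlg K n) c) = 0 :=
  CliffordAlgebra.contractLeft_algebraMap _ _ _

theorem contr_one (k : Fin n) : contr k (1 : ExtAlg K n) = 0 :=
  CliffordAlgebra.contractLeft_one _ _

theorem contr_e_mul (k l : Fin n) (x : ExtAlg K n) :
    contr k (e K l * x) = (if k = l then x else 0) - e K l * contr k x := by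
  rw [e, contr_linForm_mul, Pi.single_apply, ite_smul, one_smul, zero_smul]

theorem contr_mem (k : Fin n) {j : ℤ} {x : ExtAlg K n} (hx : x ∈ gr K n j) :
    contr k x ∈ gr K n (j - 1) := by
  rcases lt_or_ge j 0 with h | h
  · rw [gr_of_neg h, Submodule.mem_bot] at hx
    simp [hx]
  lift j to ℕ using h
  induction j generalizing x with
  | zero =>
    obtain ⟨c, rfl⟩ := mem_gr_zero (by simpa using hx)
    simp [contr_algebraMap]
  | succ m ih =>
    obtain ⟨y, hy, rfl⟩ := exists_eq_sum_e_mul (by positivity) hx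
    have hm : ((m + 1 : ℕ) : ℤ) - 1 = m := by simp
    rw [hm] at hy ⊢
    rw [map_sum]
    refine Submodule.sum_mem _ fun l _ => ?_
    rw [contr_e_mul]
    refine sub_mem ?_ ?_
    · split_ifs
      exacts [hy l, zero_mem _]
    · simpa using mul_mem_gr (e_mem_gr (K := K) l) (ih (hy l))

theorem linForm_mul_self (v : Fin n → K) : linForm v * linForm v = 0 :=
  ExteriorAlgebra.ι_sq_zero v

theorem linForm_mul_swap (v w : Fin n → K) : linForm v * linForm w = -(linForm w * linForm v) :=
  eq_neg_of_add_eq_zero_left (ExteriorAlgebra.ι_add_mul_swap v w)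

/-! ### Graded modules -/

/-- The submodules `𝓜 k` are independent, and `E_i • 𝓜 j ⊆ 𝓜 (i + j)`. -/
structure IsGraded {M : Type*} [AddCommGroup M] [Module K M] [Module (ExtAlg K n) M]
    (𝓜 : ℤ → Submodule K M) : Prop where
  smul_mem : ∀ {i j : ℤ} {a : ExtAlg K n} {m : M}, a ∈ gr K n i → m ∈ 𝓜 j → a • m ∈ 𝓜 (i + j)
  eq_zero : ∀ (s : Finset ℤ) (x : ℤ → M), (∀ k, x k ∈ 𝓜 k) → ∑ k ∈ s, x k = 0 → ∀ k ∈ s, x k = 0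

/-- The grading of `E^r` in which the `b`-th standard basis vector has degree `deg b`. -/
def freeGr {r : ℕ} (deg : Fin r → ℤ) (j : ℤ) : Submodule K (Fin r → ExtAlg K n) :=
  Submodule.pi Set.univ fun b => gr K n (j - deg b)

theorem mem_freeGr {r : ℕ} {deg : Fin r → ℤ} {j : ℤ} {x : Fin r → ExtAlg K n} :
    x ∈ freeGr deg j ↔ ∀ b, x b ∈ gr K n (j - deg b) := by
  simp [freeGr, Submodule.mem_pi]

section

variable {M : Type*} [AddCommGroup M] [Module K M] [Module (ExtAlg K n) M]
  [IsScalarTower K (ExtAlg K n) M] {𝓜 : ℤ → Submodule K M}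

theorem IsGraded.eq_of_sum (h𝓜 : IsGraded (n := n) 𝓜) {s : Finset ℤ} {x : ℤ → M}
    (hx : ∀ k, x k ∈ 𝓜 k) {j : ℤ} (hj : j ∈ s) (hs : ∑ k ∈ s, x k ∈ 𝓜 j) :
    ∑ k ∈ s, x k = x j := by
  classical
  -- Independence is applied to the family with the whole sum subtracted from its `j`-th term.
  have h := h𝓜.eq_zero s (fun k => x k - if k = j then ∑ k ∈ s, x k else 0) (fun k => ?_) ?_ j hj
  · simpa [sub_eq_zero, eq_comm] using h
  · refine sub_mem (hx k) ?_
    split_ifs with hk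
    exacts [hk ▸ hs, zero_mem _]
  · rw [Finset.sum_sub_distrib, Finset.sum_ite_eq' s j, if_pos hj, sub_self]

theorem IsGraded.e_smul_mem (h𝓜 : IsGraded (n := n) 𝓜) (k : Fin n) {j : ℤ} {m : M}
    (hm : m ∈ 𝓜 (j - 1)) : e K k • m ∈ 𝓜 j := by
  simpa using h𝓜.smul_mem (e_mem_gr (K := K) k) hm

theorem isGraded_gr : IsGraded (n := n) (gr K n) where
  smul_mem := mul_mem_gr
  eq_zero s x hx h k hk := by
    have := congrArg (gproj K n k) h
    rwa [map_sum, map_zero, Finset.sum_eq_single_of_mem k hk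
      (fun i _ hi => gproj_of_mem_ne (hx i) hi.symm), gproj_of_mem (hx k)] at this

theorem isGraded_freeGr {r : ℕ} (deg : Fin r → ℤ) :
    IsGraded (n := n) (freeGr (K := K) (n := n) deg) where
  smul_mem {i j a m} ha hm := by
    rw [mem_freeGr] at hm ⊢
    intro b
    rw [add_sub_assoc]
    exact mul_mem_gr ha (hm b)
  eq_zero s x hx h k hk := by
    funext b
    have h' := congrArg (gproj K n (k - deg b)) (congrFun h b)
    rw [Finset.sum_apply, Pi.zero_apply, map_sum, map_zero, Finset.sum_eq_single_of_mem k hk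
      (fun i _ hi => gproj_of_mem_ne (mem_freeGr.1 (hx i) b) (by omega)),
      gproj_of_mem (mem_freeGr.1 (hx k) b)] at h'
    exact h'

/-- A linear map between graded modules induces a grading of its kernel. -/
def kerGr {r : ℕ} (deg : Fin r → ℤ) (φ : (Fin r → ExtAlg K n) →ₗ[ExtAlg K n] M) (j : ℤ) :
    Submodule K (LinearMap.ker φ) :=
  (freeGr deg j).comap ((LinearMap.ker φ).subtype.restrictScalars K)

theorem isGraded_comap {N : Submodule (ExtAlg K n) M} (h𝓜 : IsGraded (n := n) 𝓜) :
    IsGraded (n := n) fun j => (𝓜 j).comap (N.subtype.restrictScalars K) where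
  smul_mem ha hm := h𝓜.smul_mem ha hm
  eq_zero s x hx h k hk := by
    refine Subtype.ext (h𝓜.eq_zero s (fun k => x k) hx ?_ k hk)
    simpa using congrArg Subtype.val h

theorem isGraded_kerGr {r : ℕ} (deg : Fin r → ℤ)
    (φ : (Fin r → ExtAlg K n) →ₗ[ExtAlg K n] M) : IsGraded (n := n) (kerGr deg φ) :=
  isGraded_comap (isGraded_freeGr deg)

variable {r : ℕ} {deg : Fin r → ℤ} {φ : (Fin r → ExtAlg K n) →ₗ[ExtAlg K n] M}

theorem map_eq_sum (φ : (Fin r → ExtAlg K n) →ₗ[ExtAlg K n] M) (x : Fin r → ExtAlg K n) :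
    φ x = ∑ b, x b • φ (Pi.single b 1) := by
  conv_lhs => rw [pi_eq_sum_univ' x]
  simp only [map_sum, map_smul]

theorem map_mem (h𝓜 : IsGraded (n := n) 𝓜) (hφ : ∀ b, φ (Pi.single b 1) ∈ 𝓜 (deg b)) {j : ℤ}
    {x : Fin r → ExtAlg K n} (hx : x ∈ freeGr deg j) : φ x ∈ 𝓜 j := by
  rw [map_eq_sum]
  refine Submodule.sum_mem _ fun b _ => ?_
  simpa using h𝓜.smul_mem (mem_freeGr.1 hx b) (hφ b)

theorem exists_sum_freeGr (deg : Fin r → ℤ) (j : ℤ) (x : Fin r → ExtAlg K n) :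
    ∃ (s : Finset ℤ) (y : ℤ → Fin r → ExtAlg K n), j ∈ s ∧ (∀ k, y k ∈ freeGr deg k) ∧
      ∑ k ∈ s, y k = x := by
  classical
  refine ⟨insert j (Finset.univ.biUnion fun b : Fin r => (Finset.range (n + 1)).image
    fun m : ℕ => (m : ℤ) + deg b), fun k b => gproj K n (k - deg b) (x b),
    Finset.mem_insert_self _ _, fun k => mem_freeGr.2 fun b => gproj_mem _ _, ?_⟩
  funext b
  rw [Finset.sum_apply]
  refine sum_gproj _ _ (fun m hm => Finset.mem_insert_of_mem ?_) _
  exact Finset.mem_biUnion.2 ⟨b, Finset.mem_univ _, Finset.mem_image.2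
    ⟨m, Finset.mem_range.2 (Nat.lt_succ_of_le hm), rfl⟩⟩

/-- Keep only the degree `j` component of a preimage: the images of the other components must cancel
out of a homogeneous value. -/
theorem exists_freeGr_of_map_mem (h𝓜 : IsGraded (n := n) 𝓜)
    (hφ : ∀ b, φ (Pi.single b 1) ∈ 𝓜 (deg b)) {j : ℤ} {x : Fin r → ExtAlg K n}
    (hx : φ x ∈ 𝓜 j) : ∃ y ∈ freeGr deg j, φ y = φ x := by
  obtain ⟨s, y, hj, hy, rfl⟩ := exists_sum_freeGr deg j x
  refine ⟨y j, hy j, ?_⟩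
  rw [map_sum] at hx ⊢
  exact (h𝓜.eq_of_sum (fun k => map_mem h𝓜 hφ (hy k)) hj hx).symm

/-! ### The Cartan complex -/

/-- The total degree of a multi-index. -/
def mdeg (a : Fin n → ℕ) : ℕ := ∑ k, a k

theorem mdeg_add_single (a : Fin n → ℕ) (k : Fin n) : mdeg (a + Pi.single k 1) = mdeg a + 1 := by
  simp [mdeg, Finset.sum_add_distrib]

theorem mdeg_eq_zero {a : Fin n → ℕ} : mdeg a = 0 ↔ a = 0 := by
  simp [mdeg, funext_iff]

/-- The Cartan chains of homological degree `p` and internal degree `j` with values in `M`. -/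
def chains (𝓜 : ℤ → Submodule K M) (p : ℕ) (j : ℤ) : Submodule K ((Fin n → ℕ) → M) where
  carrier := {f | ∀ a, f a ∈ 𝓜 (j - mdeg a) ∧ (mdeg a ≠ p → f a = 0)}
  add_mem' {f g} hf hg a := ⟨add_mem (hf a).1 (hg a).1, fun h => by
    rw [Pi.add_apply, (hf a).2 h, (hg a).2 h, add_zero]⟩
  zero_mem' a := ⟨zero_mem _, fun _ => rfl⟩
  smul_mem' c f hf a := ⟨Submodule.smul_mem _ c (hf a).1, fun h => by
    rw [Pi.smul_apply, (hf a).2 h, smul_zero]⟩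

variable (K n M) in
/-- The differential of the Cartan complex. -/
def bd : ((Fin n → ℕ) → M) →ₗ[K] ((Fin n → ℕ) → M) where
  toFun f a := ∑ k, e K k • f (a + Pi.single k 1)
  map_add' f g := by
    funext a
    simp [Finset.sum_add_distrib]
  map_smul' c f := by
    funext a
    simp only [Pi.smul_apply, RingHom.id_apply, Finset.smul_sum]
    exact Finset.sum_congr rfl fun k _ => by
      rw [← algebraMap_smul (ExtAlg K n) c, ← algebraMap_smul (ExtAlg K n) c, smul_smul, smul_smul,
        Algebra.commutes]

theorem bd_apply (f : (Fin n → ℕ) → M) (a : Fin n → ℕ) :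
    bd K n M f a = ∑ k, e K k • f (a + Pi.single k 1) := rfl

theorem bd_bd (f : (Fin n → ℕ) → M) : bd K n M (bd K n M f) = 0 := by
  classical
  funext a
  simp only [bd_apply, Finset.smul_sum, smul_smul, Pi.zero_apply]
  rw [← Finset.sum_product']
  -- The terms for `(k, l)` and `(l, k)` cancel by anticommutativity, and the diagonal terms vanish
  -- because `e_k ∧ e_k = 0`.
  refine Finset.sum_involution (fun p _ => p.swap) (fun p _ => ?_) (fun p _ hp h => hp ?_)
    (fun _ _ => Finset.mem_univ _) (fun _ _ => rfl)
  · rw [Prod.fst_swap, Prod.snd_swap, add_right_comm a, ← add_smul, e, e, linForm_mul_swap,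
      neg_add_cancel, zero_smul]
  · obtain ⟨k, l⟩ := p
    obtain rfl : l = k := congrArg Prod.fst h
    rw [e, linForm_mul_self, zero_smul]

theorem bd_mem (h𝓜 : IsGraded (n := n) 𝓜) {p : ℕ} {j : ℤ} {f : (Fin n → ℕ) → M}
    (hf : f ∈ chains 𝓜 (p + 1) j) : bd K n M f ∈ chains 𝓜 p j := by
  intro a
  rw [bd_apply]
  refine ⟨Submodule.sum_mem _ fun k _ => h𝓜.e_smul_mem k ?_, fun ha =>
    Finset.sum_eq_zero fun k _ => ?_⟩
  · have := (hf (a + Pi.single k 1)).1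
    rw [mdeg_add_single] at this
    convert this using 2
    push_cast
    ring
  · rw [(hf _).2 (by rw [mdeg_add_single]; omega), smul_zero]

theorem bd_eq_zero {j : ℤ} {f : (Fin n → ℕ) → M} (hf : f ∈ chains 𝓜 0 j) : bd K n M f = 0 := by
  funext a
  rw [bd_apply, Pi.zero_apply]
  refine Finset.sum_eq_zero fun k _ => ?_
  rw [(hf _).2 (by rw [mdeg_add_single]; omega), smul_zero]

theorem bd_comp {N : Type*} [AddCommGroup N] [Module K N] [Module (ExtAlg K n) N]
    [IsScalarTower K (ExtAlg K n) N] (φ : M →ₗ[ExtAlg K n] N) (f : (Fin n → ℕ) → M) :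
    bd K n N (φ ∘ f) = φ ∘ bd K n M f := by
  funext a
  simp [bd_apply]

/-- The Cartan homology `H_p(e_1, …, e_n; M)_j`. -/
abbrev CartanHomology (𝓜 : ℤ → Submodule K M) (p : ℕ) (j : ℤ) : Type _ :=
  (chains 𝓜 p j ⊓ LinearMap.ker (bd K n M) : Submodule K _) ⧸
    ((chains 𝓜 (p + 1) j).map (bd K n M)).submoduleOf (chains 𝓜 p j ⊓ LinearMap.ker (bd K n M))

end

/-! ### Acyclicity for free modules -/

section

variable {r : ℕ} {deg : Fin r → ℤ}

/-- Shifting and contracting, a homotopy for the `k`-th part of the Cartan differential. -/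
def homotopy (k : Fin n) (f : (Fin n → ℕ) → Fin r → ExtAlg K n) :
    (Fin n → ℕ) → Fin r → ExtAlg K n :=
  fun a b => if a k = 0 then 0 else contr k (f (a - Pi.single k 1) b)

/-- The part of a Cartan chain not reached by `homotopy`. -/
def residue (k : Fin n) (f : (Fin n → ℕ) → Fin r → ExtAlg K n) :
    (Fin n → ℕ) → Fin r → ExtAlg K n :=
  fun a b => if a k = 0 then contr k (e K k * f a b) else 0

theorem sub_single_add_single {a : Fin n → ℕ} {k : Fin n} (h : a k ≠ 0) :
    a - Pi.single k 1 + Pi.single k 1 = a := by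
  funext l
  by_cases hl : l = k
  · subst hl
    simp
    omega
  · simp [hl]

/-- For `a k ≠ 0`, contracting the cycle condition at `a - ε_k` with the `k`-th coordinate expresses
`f a` as the boundary of the homotopy. For `a k = 0` only the `k`-th summand of the boundary
survives, and what is missing is `contr k (e_k ∧ f a)`. -/
theorem bd_homotopy {k : Fin n} {f : (Fin n → ℕ) → Fin r → ExtAlg K n} (hf : bd K n _ f = 0) :
    bd K n _ (homotopy k f) + residue k f = f := by
  funext a b
  have h1 : ∀ l, l ≠ k → a k = 0 → homotopy k f (a + Pi.single l 1) b = 0 := by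
    intro l hl ha
    simp [homotopy, ha, hl.symm]
  have h2 : homotopy k f (a + Pi.single k 1) b = contr k (f a b) := by
    simp [homotopy]
  simp only [Pi.add_apply, bd_apply, Finset.sum_apply, Pi.smul_apply, smul_eq_mul]
  by_cases ha : a k = 0
  · rw [Finset.sum_eq_single_of_mem k (Finset.mem_univ _)
      (fun l _ hl => by rw [h1 l hl ha, mul_zero]), h2, residue, if_pos ha, contr_e_mul, if_pos rfl]
    abel
  · have h3 : ∀ l, homotopy k f (a + Pi.single l 1) b =
        contr k (f (a - Pi.single k 1 + Pi.single l 1) b) := by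
      intro l
      have : a + Pi.single l 1 - Pi.single k 1 = a - Pi.single k 1 + Pi.single l 1 := by
        conv_lhs => rw [← sub_single_add_single ha, add_right_comm, add_tsub_cancel_right]
      rw [homotopy, if_neg (by simp [ha]), this]
    have h4 := congrArg (contr k) (congrFun (congrFun hf (a - Pi.single k 1)) b)
    simp only [bd_apply, Finset.sum_apply, Pi.smul_apply, smul_eq_mul, map_sum, contr_e_mul,
      Finset.sum_sub_distrib, Finset.sum_ite_eq, Finset.mem_univ, if_true, Pi.zero_apply, map_zero,
      sub_single_add_single ha] at h4
    simp only [h3, residue, if_neg ha, add_zero]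
    exact (sub_eq_zero.1 h4).symm

theorem homotopy_mem (k : Fin n) {p : ℕ} {j : ℤ} {f : (Fin n → ℕ) → Fin r → ExtAlg K n}
    (hf : f ∈ chains (freeGr deg) p j) : homotopy k f ∈ chains (freeGr deg) (p + 1) j := by
  intro a
  by_cases ha : a k = 0
  · have : homotopy k f a = 0 := by
      funext b
      simp [homotopy, ha]
    rw [this]
    exact ⟨zero_mem _, fun _ => rfl⟩
  · have hd : mdeg a = mdeg (a - Pi.single k 1) + 1 := by
      rw [← mdeg_add_single, sub_single_add_single ha]
    refine ⟨mem_freeGr.2 fun b => ?_, fun h => ?_⟩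
    · have := contr_mem k (mem_freeGr.1 (hf (a - Pi.single k 1)).1 b)
      simp only [homotopy, if_neg ha]
      convert this using 2
      push_cast [hd]
      ring
    · funext b
      simp [homotopy, (hf (a - Pi.single k 1)).2 (by omega)]

theorem residue_mem (k : Fin n) {p : ℕ} {j : ℤ} {f : (Fin n → ℕ) → Fin r → ExtAlg K n}
    (hf : f ∈ chains (freeGr deg) p j) : residue k f ∈ chains (freeGr deg) p j := by
  refine fun a => ⟨mem_freeGr.2 fun b => ?_, fun h => ?_⟩
  · have h1 := contr_mem k (mul_mem_gr (e_mem_gr (K := K) k) (mem_freeGr.1 (hf a).1 b))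
    rw [add_sub_cancel_left] at h1
    unfold residue
    split_ifs
    exacts [h1, zero_mem _]
  · funext b
    simp [residue, (hf a).2 h]

/-- The variables are eliminated one at a time: modulo a boundary, the cycle is replaced by its
residue, which is supported where `a k = 0`. A residue at `a` depends only on the value at `a`, so
earlier vanishing persists. In the end only `a = 0` is left, and its degree is not `p`. -/
theorem exists_eq_bd {p : ℕ} (hp : p ≠ 0) {j : ℤ} {f : (Fin n → ℕ) → Fin r → ExtAlg K n}
    (hf : f ∈ chains (freeGr deg) p j) (h : bd K n _ f = 0) :
    ∃ g ∈ chains (freeGr deg) (p + 1) j, bd K n _ g = f := by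
  classical
  have key : ∀ s : Finset (Fin n), ∃ g ∈ chains (freeGr deg) (p + 1) j,
      ∃ f' ∈ chains (freeGr deg) p j, bd K n _ g + f' = f ∧ ∀ a, (∃ k ∈ s, a k ≠ 0) → f' a = 0 := by
    intro s
    induction s using Finset.induction_on with
    | empty => exact ⟨0, zero_mem _, f, hf, by simp, by simp⟩
    | insert k s _ ih =>
      obtain ⟨g, hg, f', hf', hgf, h0⟩ := ih
      have hb : bd K n _ f' = 0 := by
        have := congrArg (bd K n _) hgf
        rwa [map_add, bd_bd, zero_add, h] at this
      refine ⟨g + homotopy k f', add_mem hg (homotopy_mem k hf'), residue k f', residue_mem k hf',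
        by rw [map_add, add_assoc, bd_homotopy hb, hgf], ?_⟩
      rintro a ⟨l, hl, ha⟩
      funext b
      rcases Finset.mem_insert.1 hl with rfl | hl
      · simp [residue, ha]
      · simp [residue, h0 a ⟨l, hl, ha⟩]
  obtain ⟨g, hg, f', hf', hgf, h0⟩ := key Finset.univ
  refine ⟨g, hg, ?_⟩
  suffices f' = 0 by simpa [this] using hgf
  funext a
  by_cases ha : a = 0
  · exact (hf' a).2 (by simpa [ha, mdeg] using hp.symm)
  · obtain ⟨k, hk⟩ := Function.ne_iff.1 ha
    exact h0 a ⟨k, Finset.mem_univ _, hk⟩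

/-- The augmentation `E^r → K^r`. -/
def aug (K : Type*) [Field K] (n r : ℕ) : (Fin r → ExtAlg K n) →ₗ[K] (Fin r → K) :=
  (ExteriorAlgebra.algebraMapInv (R := K) (M := Fin n → K)).toLinearMap.compLeft (Fin r)

theorem aug_apply (x : Fin r → ExtAlg K n) (b : Fin r) :
    aug K n r x b = ExteriorAlgebra.algebraMapInv (x b) := rfl

/-- The inclusion `K^r → E^r`. -/
def const (K : Type*) [Field K] (n r : ℕ) : (Fin r → K) →ₗ[K] (Fin r → ExtAlg K n) :=
  (Algebra.linearMap K (ExtAlg K n)).compLeft (Fin r)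

theorem const_apply (u : Fin r → K) (b : Fin r) :
    const K n r u b = algebraMap K (ExtAlg K n) (u b) := rfl

theorem aug_const (u : Fin r → K) : aug K n r (const K n r u) = u := by
  funext b
  rw [aug_apply, const_apply, algebraMapInv_algebraMap]

theorem aug_smul (a : ExtAlg K n) (x : Fin r → ExtAlg K n) :
    aug K n r (a • x) = (ExteriorAlgebra.algebraMapInv a : K) • aug K n r x := by
  funext b
  simp [aug_apply]

theorem aug_sum_e_smul (y : Fin n → Fin r → ExtAlg K n) : aug K n r (∑ k, e K k • y k) = 0 := by
  simp [map_sum, aug_smul, e, algebraMapInv_linForm]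

theorem exists_eq_sum_e_smul {j : ℤ} {x : Fin r → ExtAlg K n} (hx : x ∈ freeGr deg j)
    (h : aug K n r x = 0) :
    ∃ y : Fin n → Fin r → ExtAlg K n, (∀ k, y k ∈ freeGr deg (j - 1)) ∧ x = ∑ k, e K k • y k := by
  choose y hy hxy using fun b =>
    exists_eq_sum_e_mul_of_algebraMapInv (mem_freeGr.1 hx b) (congrFun h b)
  refine ⟨fun k b => y b k, fun k => mem_freeGr.2 fun b => ?_, ?_⟩
  · rw [sub_right_comm]
    exact hy b k
  · funext b
    simpa using hxy b

end

/-! ### Comparing subquotients -/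

/-- The subquotients are compared through a linear relation, as in a diagram chase where neither
direction is given by a map on chains. The part of `S` lying over cycles on both sides surjects onto
both quotients, with the same kernel. -/
theorem finrank_eq_of_relation {U V W : Type*} [AddCommGroup U] [Module K U] [AddCommGroup V]
    [Module K V] [AddCommGroup W] [Module K W] {ZU BU : Submodule K U} {ZV BV : Submodule K V}
    (S : Submodule K W) (p : W →ₗ[K] U) (q : W →ₗ[K] V)
    (hU : ∀ u ∈ ZU, ∃ w ∈ S, p w = u ∧ q w ∈ ZV)
    (hV : ∀ v ∈ ZV, ∃ w ∈ S, q w = v ∧ p w ∈ ZU)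
    (hUV : ∀ w ∈ S, p w ∈ BU → q w ∈ ZV → q w ∈ BV)
    (hVU : ∀ w ∈ S, q w ∈ BV → p w ∈ ZU → p w ∈ BU) :
    Module.finrank K (ZU ⧸ BU.submoduleOf ZU) = Module.finrank K (ZV ⧸ BV.submoduleOf ZV) := by
  let T : Submodule K W := S ⊓ (ZU.comap p ⊓ ZV.comap q)
  let f : T →ₗ[K] ZU ⧸ BU.submoduleOf ZU :=
    (BU.submoduleOf ZU).mkQ ∘ₗ (p ∘ₗ T.subtype).codRestrict ZU fun w => w.2.2.1
  let g : T →ₗ[K] ZV ⧸ BV.submoduleOf ZV :=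
    (BV.submoduleOf ZV).mkQ ∘ₗ (q ∘ₗ T.subtype).codRestrict ZV fun w => w.2.2.2
  have hf : Function.Surjective f := by
    refine (Submodule.mkQ_surjective _).comp fun u => ?_
    obtain ⟨w, hw, hpw, hqw⟩ := hU u u.2
    exact ⟨⟨w, hw, by simp [hpw], hqw⟩, Subtype.ext hpw⟩
  have hg : Function.Surjective g := by
    refine (Submodule.mkQ_surjective _).comp fun v => ?_
    obtain ⟨w, hw, hqw, hpw⟩ := hV v v.2
    exact ⟨⟨w, hw, hpw, by simp [hqw]⟩, Subtype.ext hqw⟩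
  have hk : LinearMap.ker f = LinearMap.ker g := by
    ext w
    have h1 : w ∈ LinearMap.ker f ↔ p w ∈ BU := Submodule.Quotient.mk_eq_zero _
    have h2 : w ∈ LinearMap.ker g ↔ q w ∈ BV := Submodule.Quotient.mk_eq_zero _
    rw [h1, h2]
    exact ⟨fun h => hUV w w.2.1 h w.2.2.2, fun h => hVU w w.2.1 h w.2.2.1⟩
  exact ((f.quotKerEquivOfSurjective hf).symm.trans ((Submodule.quotEquivOfEq _ _ hk).trans
    (g.quotKerEquivOfSurjective hg))).finrank_eq

/-! ### Lifting chains -/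

section

variable {M N : Type*} [AddCommGroup M] [Module K M] [Module (ExtAlg K n) M]
  [IsScalarTower K (ExtAlg K n) M] {𝓜 : ℤ → Submodule K M}
  [AddCommGroup N] [Module K N] [Module (ExtAlg K n) N]
  [IsScalarTower K (ExtAlg K n) N] {𝓝 : ℤ → Submodule K N}

theorem exists_chains_lift {φ : N →ₗ[ExtAlg K n] M} {p : ℕ} {j : ℤ} {f : (Fin n → ℕ) → M}
    (h : ∀ a, ∃ y ∈ 𝓝 (j - mdeg a), φ y = f a) (hf : f ∈ chains 𝓜 p j) :
    ∃ g ∈ chains 𝓝 p j, φ ∘ g = f := by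
  choose y hy hyf using h
  -- A chosen lift of `0` need not be `0`, so the lifts outside total degree `p` are discarded.
  refine ⟨fun a => if mdeg a = p then y a else 0, fun a => ⟨?_, fun ha => if_neg ha⟩, ?_⟩
  · dsimp only
    split_ifs
    exacts [hy a, zero_mem _]
  · funext a
    by_cases ha : mdeg a = p
    · simp [ha, hyf]
    · simp [ha, (hf a).2 ha]

theorem comp_mem_chains {φ : N →ₗ[ExtAlg K n] M} (hφ : ∀ j, ∀ y ∈ 𝓝 j, φ y ∈ 𝓜 j) {p : ℕ} {j : ℤ}
    {f : (Fin n → ℕ) → N} (hf : f ∈ chains 𝓝 p j) : φ ∘ f ∈ chains 𝓜 p j :=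
  fun a => ⟨hφ _ _ (hf a).1, fun h => by simp [(hf a).2 h]⟩

theorem single_mem_chains {j : ℤ} {m : M} (hm : m ∈ 𝓜 j) :
    (Pi.single 0 m : (Fin n → ℕ) → M) ∈ chains 𝓜 0 j := by
  intro a
  by_cases ha : a = 0
  · subst ha
    have : mdeg (0 : Fin n → ℕ) = 0 := mdeg_eq_zero.2 rfl
    simpa [this] using hm
  · rw [Pi.single_eq_of_ne ha]
    exact ⟨zero_mem _, fun _ => rfl⟩

theorem eq_single_of_mem_chains {j : ℤ} {f : (Fin n → ℕ) → M} (hf : f ∈ chains 𝓜 0 j) :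
    f = Pi.single 0 (f 0) := by
  funext a
  by_cases ha : a = 0
  · subst ha
    simp
  · rw [Pi.single_eq_of_ne ha, (hf a).2 (mt mdeg_eq_zero.1 ha)]

theorem mem_of_mem_chains {j : ℤ} {f : (Fin n → ℕ) → M} (hf : f ∈ chains 𝓜 0 j) : f 0 ∈ 𝓜 j := by
  have : mdeg (0 : Fin n → ℕ) = 0 := mdeg_eq_zero.2 rfl
  simpa [this] using (hf 0).1

/-- The Cartan chain of degree `1` with given coefficients. -/
def chainOne (y : Fin n → M) : (Fin n → ℕ) → M := ∑ k, Pi.single (Pi.single k 1) (y k)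

theorem chainOne_single (y : Fin n → M) (k : Fin n) : chainOne y (Pi.single k 1) = y k := by
  rw [chainOne, Finset.sum_apply, Finset.sum_eq_single_of_mem k (Finset.mem_univ _), Pi.single_eq_same]
  intro l _ hl
  rw [Pi.single_eq_of_ne]
  intro h
  have := congrFun h k
  simp [hl.symm] at this

theorem chainOne_mem {j : ℤ} {y : Fin n → M} (hy : ∀ k, y k ∈ 𝓜 (j - 1)) :
    chainOne y ∈ chains 𝓜 1 j := by
  refine Submodule.sum_mem _ fun k _ a => ?_
  have hd : mdeg (Pi.single k 1 : Fin n → ℕ) = 1 := by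
    simpa [mdeg_eq_zero.2 rfl] using mdeg_add_single 0 k
  by_cases ha : a = Pi.single k 1
  · subst ha
    rw [Pi.single_eq_same, hd]
    exact ⟨by simpa using hy k, fun h => absurd rfl h⟩
  · rw [Pi.single_eq_of_ne ha]
    exact ⟨zero_mem _, fun _ => rfl⟩

theorem bd_apply_zero (f : (Fin n → ℕ) → M) : bd K n M f 0 = ∑ k, e K k • f (Pi.single k 1) := by
  simp [bd_apply]

theorem bd_chainOne_zero (y : Fin n → M) : bd K n M (chainOne y) 0 = ∑ k, e K k • y k := by
  simp [bd_apply_zero, chainOne_single]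

theorem mem_of_mem_chains_one {j : ℤ} {f : (Fin n → ℕ) → M} (hf : f ∈ chains 𝓜 1 j) (k : Fin n) :
    f (Pi.single k 1) ∈ 𝓜 (j - 1) := by
  have hd : mdeg (Pi.single k 1 : Fin n → ℕ) = 1 := by
    simpa [mdeg_eq_zero.2 rfl] using mdeg_add_single 0 k
  simpa [hd] using (hf (Pi.single k 1)).1

end

/-! ### Tor as Cartan homology -/

namespace GradedFreeResolution

variable {M : Type u} [AddCommGroup M] [Module K M] [Module (ExtAlg K n) M]
  [IsScalarTower K (ExtAlg K n) M] {𝓜 : ℤ → Submodule K M} (F : GradedFreeResolution n 𝓜)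

theorem aug_map_mem (h𝓜 : IsGraded (n := n) 𝓜) {j : ℤ} {y : Fin (F.rank 0) → ExtAlg K n}
    (hy : y ∈ freeGr (F.deg 0) j) : F.aug y ∈ 𝓜 j :=
  map_mem h𝓜 F.aug_homogeneous hy

theorem d_single_mem (i : ℕ) (b) : F.d i (Pi.single b 1) ∈ freeGr (F.deg i) (F.deg (i + 1) b) :=
  mem_freeGr.2 fun b' => F.d_homogeneous i b b'

theorem d_mem {i : ℕ} {j : ℤ} {y : Fin (F.rank (i + 1)) → ExtAlg K n}
    (hy : y ∈ freeGr (F.deg (i + 1)) j) : F.d i y ∈ freeGr (F.deg i) j :=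
  map_mem (isGraded_freeGr _) (F.d_single_mem i) hy

theorem exists_aug_eq (h𝓜 : IsGraded (n := n) 𝓜) {j : ℤ} {m : M} (hm : m ∈ 𝓜 j) :
    ∃ y ∈ freeGr (F.deg 0) j, F.aug y = m := by
  obtain ⟨x, rfl⟩ := F.aug_surjective m
  exact exists_freeGr_of_map_mem h𝓜 F.aug_homogeneous hm

theorem aug_d (y) : F.aug (F.d 0 y) = 0 := (F.exact_zero _).2 ⟨y, rfl⟩

theorem d_d (i) (y) : F.d i (F.d (i + 1) y) = 0 := (F.exact_succ i _).2 ⟨y, rfl⟩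

theorem exists_d_eq_of_aug {j : ℤ} {y : Fin (F.rank 0) → ExtAlg K n} (hy : y ∈ freeGr (F.deg 0) j)
    (h : F.aug y = 0) : ∃ w ∈ freeGr (F.deg 1) j, F.d 0 w = y := by
  obtain ⟨x, rfl⟩ := (F.exact_zero y).1 h
  exact exists_freeGr_of_map_mem (isGraded_freeGr _) (F.d_single_mem 0) hy

theorem exists_d_eq_of_d {i : ℕ} {j : ℤ} {y : Fin (F.rank (i + 1)) → ExtAlg K n}
    (hy : y ∈ freeGr (F.deg (i + 1)) j) (h : F.d i y = 0) :
    ∃ w ∈ freeGr (F.deg (i + 2)) j, F.d (i + 1) w = y := by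
  obtain ⟨x, rfl⟩ := (F.exact_succ i y).1 h
  exact exists_freeGr_of_map_mem (isGraded_freeGr _) (F.d_single_mem (i + 1)) hy

theorem tensorD_apply (i : ℕ) (u : Fin (F.rank (i + 1)) → K) :
    F.tensorD i u = ExtAlg.aug K n _ (F.d i (const K n _ u)) := rfl

theorem aug_d_eq_tensorD (i : ℕ) (y : Fin (F.rank (i + 1)) → ExtAlg K n) :
    ExtAlg.aug K n _ (F.d i y) = F.tensorD i (ExtAlg.aug K n _ y) := by
  rw [tensorD_apply, map_eq_sum (F.d i) y, map_eq_sum (F.d i) (const K n _ _), map_sum, map_sum]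
  refine Finset.sum_congr rfl fun b _ => ?_
  rw [aug_smul, aug_smul, const_apply, algebraMapInv_algebraMap, aug_apply]

theorem aug_mem_tensorGr {i : ℕ} {j : ℤ} {y : Fin (F.rank i) → ExtAlg K n}
    (hy : y ∈ freeGr (F.deg i) j) : ExtAlg.aug K n _ y ∈ F.tensorGr i j :=
  fun b hb => algebraMapInv_of_mem (by omega) (mem_freeGr.1 hy b)

theorem const_mem_freeGr {i : ℕ} {j : ℤ} {u : Fin (F.rank i) → K} (hu : u ∈ F.tensorGr i j) :
    const K n _ u ∈ freeGr (F.deg i) j := by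
  refine mem_freeGr.2 fun b => ?_
  by_cases hb : F.deg i b = j
  · rw [hb, sub_self]
    exact algebraMap_mem_gr _
  · rw [const_apply, hu b hb, map_zero]
    exact zero_mem _

/-- The resolution of the first syzygy module. -/
def syzygy : GradedFreeResolution n (kerGr (F.deg 0) F.aug) where
  rank i := F.rank (i + 1)
  deg i := F.deg (i + 1)
  d i := F.d (i + 1)
  aug := (F.d 0).codRestrict (LinearMap.ker F.aug) F.aug_d
  d_homogeneous i := F.d_homogeneous (i + 1)
  aug_homogeneous b := F.d_single_mem 0 b
  aug_surjective y := by
    obtain ⟨x, hx⟩ := (F.exact_zero y).1 y.2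
    exact ⟨x, Subtype.ext hx⟩
  exact_zero y := by
    rw [← F.exact_succ 0 y]
    exact Subtype.ext_iff
  exact_succ i := F.exact_succ (i + 1)

/-- Both sides are the degree `j` part of `M/(e_1, …, e_n)M`; an element of `F_0` relates its
residue in `K ⊗ F_0` to its image in `M`. -/
theorem finrank_tor_zero (h𝓜 : IsGraded (n := n) 𝓜) (j : ℤ) :
    Module.finrank K (F.Tor 0 j) = Module.finrank K (CartanHomology (n := n) 𝓜 0 j) := by
  refine finrank_eq_of_relation (freeGr (F.deg 0) j) (ExtAlg.aug K n (F.rank 0))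
    (LinearMap.single K (fun _ : Fin n → ℕ => M) 0 ∘ₗ F.aug.restrictScalars K) ?_ ?_ ?_ ?_
  · intro u hu
    have hy := F.const_mem_freeGr hu
    have hc := single_mem_chains (n := n) (F.aug_map_mem h𝓜 hy)
    exact ⟨_, hy, aug_const u, hc, bd_eq_zero hc⟩
  · rintro f ⟨hf, -⟩
    obtain ⟨y, hy, hyf⟩ := F.exists_aug_eq h𝓜 (mem_of_mem_chains hf)
    refine ⟨y, hy, ?_, F.aug_mem_tensorGr hy⟩
    simpa [hyf] using (eq_single_of_mem_chains hf).symm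
  · rintro y hy ⟨v, hv, hvy⟩ -
    have hv' := F.const_mem_freeGr hv
    obtain ⟨z, hz, hyz⟩ := exists_eq_sum_e_smul (sub_mem hy (F.d_mem hv'))
      (by rw [map_sub, ← hvy, tensorD_apply, sub_self])
    have hz' : ∀ k, F.aug (z k) ∈ 𝓜 (j - 1) := fun k => F.aug_map_mem h𝓜 (hz k)
    refine ⟨_, chainOne_mem hz', ?_⟩
    rw [eq_single_of_mem_chains (bd_mem h𝓜 (chainOne_mem hz')), bd_chainOne_zero]
    have : F.aug y = ∑ k, e K k • F.aug (z k) := by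
      have := congrArg F.aug hyz
      simpa [F.aug_d] using this
    simp [this]
  · rintro y hy ⟨g, hg, hgy⟩ -
    choose z hz hzg using fun k => F.exists_aug_eq h𝓜 (mem_of_mem_chains_one hg k)
    have h0 : F.aug y = ∑ k, e K k • F.aug (z k) := by
      have := congrFun hgy 0
      rw [bd_apply_zero] at this
      simpa [hzg] using this.symm
    have hzs : ∑ k, e K k • z k ∈ freeGr (F.deg 0) j :=
      Submodule.sum_mem _ fun k _ => (isGraded_freeGr _).e_smul_mem k (hz k)
    obtain ⟨w, hw, hwy⟩ := F.exists_d_eq_of_aug (sub_mem hy hzs) (by simp [h0])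
    refine ⟨_, F.aug_mem_tensorGr hw, ?_⟩
    rw [← aug_d_eq_tensorD, hwy, map_sub, aug_sum_e_smul, sub_zero]

/-- This case is not reached by dimension shifting: for `Tor_0` of the syzygy module every element
of `K ⊗ F_1` is a cycle, while `Tor_1` only admits the kernel of the map to `K ⊗ F_0`. The relation
consists of the pairs of a 1-chain `g` in `F_0` and an element `y` of `F_1` whose images in `F_0`
agree, as in the double complex. -/
theorem finrank_tor_one (h𝓜 : IsGraded (n := n) 𝓜) (j : ℤ) :
    Module.finrank K (F.Tor 1 j) = Module.finrank K (CartanHomology (n := n) 𝓜 1 j) := by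
  have h𝓕 := isGraded_freeGr (K := K) (n := n) (F.deg 0)
  let P : ((Fin n → ℕ) → Fin (F.rank 0) → ExtAlg K n) × (Fin (F.rank 1) → ExtAlg K n) →ₗ[K]
      (Fin (F.rank 0) → ExtAlg K n) :=
    LinearMap.proj 0 ∘ₗ bd K n _ ∘ₗ LinearMap.fst K _ _ -
      (F.d 0).restrictScalars K ∘ₗ LinearMap.snd K _ _
  have hP : ∀ w, w ∈ LinearMap.ker P ↔ bd K n _ w.1 0 = F.d 0 w.2 := fun w => by
    rw [LinearMap.mem_ker]
    exact sub_eq_zero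
  have haug : ∀ j, ∀ y ∈ freeGr (F.deg 0) j, F.aug y ∈ 𝓜 j := fun j y hy => F.aug_map_mem h𝓜 hy
  refine finrank_eq_of_relation
    ((chains (freeGr (F.deg 0)) 1 j).prod (freeGr (F.deg 1) j) ⊓ LinearMap.ker P)
    (ExtAlg.aug K n (F.rank 1) ∘ₗ LinearMap.snd K _ _)
    ((F.aug.restrictScalars K).compLeft (Fin n → ℕ) ∘ₗ LinearMap.fst K _ _) ?_ ?_ ?_ ?_
  · rintro u ⟨hu, hu0⟩
    have hy := F.const_mem_freeGr hu
    obtain ⟨z, hz, hyz⟩ := exists_eq_sum_e_smul (F.d_mem hy) hu0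
    have hc := chainOne_mem hz
    refine ⟨(chainOne z, const K n _ u), ⟨⟨hc, hy⟩, ?_⟩, aug_const u, comp_mem_chains haug hc, ?_⟩
    · refine (hP _).2 ?_
      rw [bd_chainOne_zero, hyz]
    · change bd K n _ (F.aug ∘ chainOne z) = 0
      rw [bd_comp, eq_single_of_mem_chains (bd_mem h𝓕 hc), bd_chainOne_zero, ← hyz]
      funext a
      by_cases ha : a = 0
      · subst ha
        simp [F.aug_d]
      · simp [Pi.single_eq_of_ne ha]
  · rintro f ⟨hf, hf0⟩
    obtain ⟨g, hg, hgf⟩ := exists_chains_lift (fun a => F.exists_aug_eq h𝓜 (hf a).1) hf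
    have h0 : F.aug (bd K n _ g 0) = 0 := by
      have := congrFun (bd_comp F.aug g) 0
      rw [hgf, LinearMap.mem_ker.1 hf0] at this
      exact this.symm
    obtain ⟨y, hy, hyg⟩ := F.exists_d_eq_of_aug (mem_of_mem_chains (bd_mem h𝓕 hg)) h0
    refine ⟨(g, y), ⟨⟨hg, hy⟩, (hP _).2 hyg.symm⟩, hgf, F.aug_mem_tensorGr hy, ?_⟩
    change F.tensorD 0 (ExtAlg.aug K n _ y) = 0
    rw [← aug_d_eq_tensorD, hyg, bd_apply_zero, aug_sum_e_smul]
  · rintro ⟨g, y⟩ ⟨⟨hg, hy⟩, hgy⟩ ⟨v, hv, hvy⟩ -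
    replace hgy := (hP _).1 hgy
    dsimp at hg hy hgy hvy
    have hv' := F.const_mem_freeGr hv
    obtain ⟨z, hz, hyz⟩ := exists_eq_sum_e_smul (sub_mem hy (F.d_mem hv'))
      (by rw [map_sub, ← hvy, tensorD_apply, sub_self])
    -- With `y - d v = ∑ e_k z_k`, correcting `g` by the chain with coefficients `d z_k` makes it a
    -- cycle in `F_0`, hence a boundary. The correction is invisible in `M` since the augmentation
    -- kills `d z_k`.
    have hdz := chainOne_mem fun k => F.d_mem (hz k)
    have hc := sub_mem hg hdz
    obtain ⟨w, hw, hwg⟩ := exists_eq_bd one_ne_zero hc (by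
      rw [eq_single_of_mem_chains (bd_mem h𝓕 hc), map_sub, Pi.sub_apply, bd_chainOne_zero, hgy]
      have := congrArg (F.d 0) hyz
      rw [map_sub, F.d_d, sub_zero, map_sum] at this
      simp [this])
    refine ⟨F.aug ∘ w, comp_mem_chains haug hw, ?_⟩
    rw [bd_comp, hwg]
    funext a
    change F.aug (g a - _) = F.aug (g a)
    rw [map_sub, sub_eq_self, chainOne, Finset.sum_apply, map_sum]
    refine Finset.sum_eq_zero fun k _ => ?_
    by_cases ha : a = Pi.single k 1
    · subst ha
      rw [Pi.single_eq_same, F.aug_d]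
    · rw [Pi.single_eq_of_ne ha, map_zero]
  · rintro ⟨g, y⟩ ⟨⟨hg, hy⟩, hgy⟩ ⟨h, hh, hhg⟩ -
    replace hgy := (hP _).1 hgy
    dsimp at hg hy hgy hhg
    obtain ⟨h', hh', hhh⟩ := exists_chains_lift (fun a => F.exists_aug_eq h𝓜 (hh a).1) hh
    have hc := sub_mem hg (bd_mem h𝓕 hh')
    have hc0 : F.aug ∘ (g - bd K n _ h') = 0 := by
      have : F.aug ∘ bd K n _ h' = F.aug ∘ g := by
        rw [← bd_comp, hhh, hhg]
        rfl
      funext a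
      have := congrFun this a
      simp only [Function.comp_apply] at this
      simp [this]
    choose z hz hzg using fun k => F.exists_d_eq_of_aug (mem_of_mem_chains_one hc k)
      (congrFun hc0 _)
    have hzs : ∑ k, e K k • z k ∈ freeGr (F.deg 1) j :=
      Submodule.sum_mem _ fun k _ => (isGraded_freeGr _).e_smul_mem k (hz k)
    obtain ⟨w, hw, hwy⟩ := F.exists_d_eq_of_d (sub_mem hy hzs) (by
      rw [map_sub, ← hgy, map_sum, sub_eq_zero]
      simp only [map_smul, hzg]
      rw [← bd_apply_zero, map_sub, bd_bd, sub_zero])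
    refine ⟨_, F.aug_mem_tensorGr hw, ?_⟩
    rw [← aug_d_eq_tensorD, hwy, map_sub, aug_sum_e_smul, sub_zero]
    rfl

/-- This is the connecting isomorphism of `0 → ker → F_0 → M → 0`; the Cartan complex of `F_0` is
exact in degrees `i + 1` and `i + 2`. A pair `(g, f)` in the relation satisfies `∂f = g` in `F_0`.
-/
theorem finrank_cartanHomology_succ (h𝓜 : IsGraded (n := n) 𝓜) (i : ℕ) (j : ℤ) :
    Module.finrank K (CartanHomology (n := n) (kerGr (F.deg 0) F.aug) (i + 1) j) =
      Module.finrank K (CartanHomology (n := n) 𝓜 (i + 2) j) := by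
  have h𝓕 := isGraded_freeGr (K := K) (n := n) (F.deg 0)
  let ι := (LinearMap.ker F.aug).subtype
  have hι : ∀ j, ∀ y ∈ kerGr (F.deg 0) F.aug j, ι y ∈ freeGr (F.deg 0) j := fun j y hy => hy
  have hinj : ∀ {f g : (Fin n → ℕ) → LinearMap.ker F.aug}, ι ∘ f = ι ∘ g → f = g := fun h => by
    funext a
    exact Subtype.ext (congrFun h a)
  have haugι : ∀ f : (Fin n → ℕ) → LinearMap.ker F.aug, F.aug ∘ ι ∘ f = 0 := fun f => by
    funext a
    exact (f a).2
  have hlift : ∀ {p : ℕ} {f : (Fin n → ℕ) → Fin (F.rank 0) → ExtAlg K n},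
      f ∈ chains (freeGr (F.deg 0)) p j → F.aug ∘ f = 0 →
      ∃ g ∈ chains (kerGr (F.deg 0) F.aug) p j, ι ∘ g = f := fun hf h0 =>
    exists_chains_lift (fun a => ⟨⟨_, congrFun h0 a⟩, (hf a).1, rfl⟩) hf
  have haug : ∀ j, ∀ y ∈ freeGr (F.deg 0) j, F.aug y ∈ 𝓜 j := fun j y hy => F.aug_map_mem h𝓜 hy
  let P : ((Fin n → ℕ) → LinearMap.ker F.aug) × ((Fin n → ℕ) → Fin (F.rank 0) → ExtAlg K n) →ₗ[K]
      ((Fin n → ℕ) → Fin (F.rank 0) → ExtAlg K n) :=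
    bd K n _ ∘ₗ LinearMap.snd K _ _ -
      (ι.restrictScalars K).compLeft (Fin n → ℕ) ∘ₗ LinearMap.fst K _ _
  have hP : ∀ w, w ∈ LinearMap.ker P ↔ bd K n _ w.2 = ι ∘ w.1 := fun w => by
    rw [LinearMap.mem_ker]
    exact sub_eq_zero
  refine finrank_eq_of_relation
    ((chains (kerGr (F.deg 0) F.aug) (i + 1) j).prod (chains (freeGr (F.deg 0)) (i + 2) j) ⊓
      LinearMap.ker P) (LinearMap.fst K _ _)
    ((F.aug.restrictScalars K).compLeft (Fin n → ℕ) ∘ₗ LinearMap.snd K _ _) ?_ ?_ ?_ ?_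
  · rintro g ⟨hg, hg0⟩
    obtain ⟨f, hf, hfg⟩ := exists_eq_bd (Nat.succ_ne_zero i) (comp_mem_chains hι hg)
      (by rw [bd_comp, LinearMap.mem_ker.1 hg0]; rfl)
    refine ⟨(g, f), ⟨⟨hg, hf⟩, (hP _).2 hfg⟩, rfl, comp_mem_chains haug hf, ?_⟩
    change bd K n _ (F.aug ∘ f) = 0
    rw [bd_comp, hfg, haugι]
  · rintro f ⟨hf, hf0⟩
    obtain ⟨f', hf', hff⟩ := exists_chains_lift (fun a => F.exists_aug_eq h𝓜 (hf a).1) hf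
    obtain ⟨g, hg, hgf⟩ := hlift (bd_mem h𝓕 hf') (by
      rw [← bd_comp, hff]
      exact hf0)
    refine ⟨(g, f'), ⟨⟨hg, hf'⟩, (hP _).2 hgf.symm⟩, hff, hg, hinj ?_⟩
    change ι ∘ bd K n _ g = 0
    rw [← bd_comp, hgf, bd_bd]
  · rintro ⟨g, f⟩ ⟨⟨hg, hf⟩, hgf⟩ ⟨z, hz, hzg⟩ -
    replace hgf := (hP _).1 hgf
    dsimp at hg hf hgf hzg
    have hz' := comp_mem_chains hι hz
    obtain ⟨w, hw, hwf⟩ := exists_eq_bd (Nat.succ_ne_zero _) (sub_mem hf hz') (by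
      rw [map_sub, bd_comp, hzg, hgf, sub_self])
    refine ⟨F.aug ∘ w, comp_mem_chains haug hw, ?_⟩
    rw [bd_comp, hwf]
    funext a
    have := congrFun (haugι z) a
    simp only [Function.comp_apply] at this
    simp [this]
  · rintro ⟨g, f⟩ ⟨⟨hg, hf⟩, hgf⟩ ⟨h, hh, hhf⟩ -
    replace hgf := (hP _).1 hgf
    dsimp at hg hf hgf hhf
    obtain ⟨h', hh', hhh⟩ := exists_chains_lift (fun a => F.exists_aug_eq h𝓜 (hh a).1) hh
    obtain ⟨z, hz, hzf⟩ := hlift (sub_mem hf (bd_mem h𝓕 hh')) (by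
      have : F.aug ∘ bd K n _ h' = F.aug ∘ f := by
        rw [← bd_comp, hhh, hhf]
        rfl
      funext a
      have := congrFun this a
      simp only [Function.comp_apply] at this
      simp [this])
    refine ⟨z, hz, hinj ?_⟩
    change ι ∘ bd K n _ z = ι ∘ g
    rw [← bd_comp, hzf, map_sub, bd_bd, sub_zero, hgf]

/-- Dimension shifting to the syzygy module, whose resolution has the same Tor one step lower in
positive degrees. The right side does not involve `F`, so Tor dimensions are independent of the
resolution. -/
theorem finrank_tor {M : Type u} [AddCommGroup M] [Module K M] [Module (ExtAlg K n) M]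
    [IsScalarTower K (ExtAlg K n) M] {𝓜 : ℤ → Submodule K M} (F : GradedFreeResolution n 𝓜)
    (h𝓜 : IsGraded (n := n) 𝓜) (i : ℕ) (j : ℤ) :
    Module.finrank K (F.Tor i j) = Module.finrank K (CartanHomology (n := n) 𝓜 i j) := by
  induction i generalizing M with
  | zero => exact F.finrank_tor_zero h𝓜 j
  | succ i ih =>
    cases i with
    | zero => exact F.finrank_tor_one h𝓜 j
    | succ i =>
      rw [← F.finrank_cartanHomology_succ h𝓜, ← ih F.syzygy (isGraded_kerGr _ _)]
      rfl

end GradedFreeResolution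

/-! ### Existence of graded free resolutions -/

section

variable {M : Type u} [AddCommGroup M] [Module K M] [Module (ExtAlg K n) M]
  [IsScalarTower K (ExtAlg K n) M] {𝓜 : ℤ → Submodule K M}

/-- A finite homogeneous spanning set over `K` already generates over `E`. As `E` is finite
dimensional, kernels are again finite dimensional and the construction can be iterated. -/
theorem exists_cover [Module.Finite K M] (hs : ⨆ j, 𝓜 j = ⊤) :
    ∃ (r : ℕ) (deg : Fin r → ℤ) (φ : (Fin r → ExtAlg K n) →ₗ[ExtAlg K n] M),
      (∀ b, φ (Pi.single b 1) ∈ 𝓜 (deg b)) ∧ Function.Surjective φ := by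
  classical
  have hfg : (Submodule.span K (⋃ j, (𝓜 j : Set M))).FG := by
    rw [Submodule.span_iUnion]
    simpa [hs] using (Module.Finite.fg_top : (⊤ : Submodule K M).FG)
  obtain ⟨s, hs', hspan⟩ := (Submodule.fg_span_iff_fg_span_finset_subset _).1 hfg
  choose d hd using fun x : s => Set.mem_iUnion.1 (hs' x.2)
  refine ⟨s.card, fun b => d (s.equivFin.symm b),
    Fintype.linearCombination (ExtAlg K n) (fun b => (s.equivFin.symm b : M)), fun b => ?_,
    fun m => ?_⟩
  · rw [Fintype.linearCombination_apply_single, one_smul]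
    exact hd _
  · have hm : m ∈ Submodule.span K (s : Set M) := by
      rw [← hspan, Submodule.span_iUnion]
      simp [hs]
    change m ∈ LinearMap.range _
    rw [Fintype.range_linearCombination]
    have : Set.range (fun b => (s.equivFin.symm b : M)) = s := by
      ext x
      exact ⟨fun ⟨b, hb⟩ => hb ▸ (s.equivFin.symm b).2, fun hx => ⟨s.equivFin ⟨x, hx⟩, by simp⟩⟩
    rw [this]
    exact Submodule.span_le_restrictScalars K (ExtAlg K n) (s : Set M) hm

theorem iSup_kerGr (h𝓜 : IsGraded (n := n) 𝓜) {r : ℕ} {deg : Fin r → ℤ}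
    {φ : (Fin r → ExtAlg K n) →ₗ[ExtAlg K n] M} (hφ : ∀ b, φ (Pi.single b 1) ∈ 𝓜 (deg b)) :
    ⨆ j, kerGr deg φ j = ⊤ := by
  refine eq_top_iff.2 fun x _ => ?_
  obtain ⟨s, y, -, hy, hyx⟩ := exists_sum_freeGr deg 0 (x : Fin r → ExtAlg K n)
  have hz : ∀ k ∈ s, φ (y k) = 0 := h𝓜.eq_zero s (fun k => φ (y k)) (fun k => map_mem h𝓜 hφ (hy k))
    (by rw [← map_sum, hyx]; exact x.2)
  have : x = ∑ k ∈ s.attach, (⟨y k, hz k k.2⟩ : LinearMap.ker φ) := by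
    refine Subtype.ext ?_
    rw [← hyx, AddSubmonoidClass.coe_finsetSum, Finset.sum_attach s y]
  rw [this]
  exact Submodule.sum_mem _ fun k _ => Submodule.mem_iSup_of_mem (k : ℤ) (hy k)

theorem exists_next (h𝓜 : IsGraded (n := n) 𝓜) {r : ℕ} {deg : Fin r → ℤ}
    {φ : (Fin r → ExtAlg K n) →ₗ[ExtAlg K n] M} (hφ : ∀ b, φ (Pi.single b 1) ∈ 𝓜 (deg b)) :
    ∃ (r' : ℕ) (deg' : Fin r' → ℤ) (d : (Fin r' → ExtAlg K n) →ₗ[ExtAlg K n] (Fin r → ExtAlg K n)),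
      (∀ b, d (Pi.single b 1) ∈ freeGr deg (deg' b)) ∧ Function.Exact d φ := by
  have : Module.Finite K (LinearMap.ker φ) :=
    inferInstanceAs (Module.Finite K ((LinearMap.ker φ).restrictScalars K))
  obtain ⟨r', deg', d, hd, hs⟩ := exists_cover (n := n) (iSup_kerGr h𝓜 hφ)
  refine ⟨r', deg', (LinearMap.ker φ).subtype ∘ₗ d, hd, fun x => ⟨fun hx => ?_, ?_⟩⟩
  · obtain ⟨y, hy⟩ := hs ⟨x, hx⟩
    exact ⟨y, congrArg Subtype.val hy⟩
  · rintro ⟨y, rfl⟩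
    exact (d y).2

end

/-- A homogeneous map between graded free modules. -/
structure FreeMap (K : Type u) [Field K] (n : ℕ) where
  /-- the rank of the target -/
  rank : ℕ
  /-- the degrees of the basis vectors of the target -/
  deg : Fin rank → ℤ
  /-- the rank of the source -/
  rank' : ℕ
  /-- the degrees of the basis vectors of the source -/
  deg' : Fin rank' → ℤ
  /-- the map -/
  d : (Fin rank' → ExtAlg K n) →ₗ[ExtAlg K n] (Fin rank → ExtAlg K n)
  homogeneous : ∀ b, d (Pi.single b 1) ∈ freeGr deg (deg' b)

/-- A free cover of the kernel. -/
def FreeMap.next (S : FreeMap K n) : FreeMap K n :=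
  have h := exists_next (isGraded_freeGr S.deg) S.homogeneous
  ⟨S.rank', S.deg', h.choose, h.choose_spec.choose, h.choose_spec.choose_spec.choose,
    h.choose_spec.choose_spec.choose_spec.1⟩

theorem FreeMap.exact_next (S : FreeMap K n) : Function.Exact S.next.d S.d :=
  (exists_next (isGraded_freeGr S.deg) S.homogeneous).choose_spec.choose_spec.choose_spec.2

theorem nonempty_gradedFreeResolution {M : Type u} [AddCommGroup M] [Module K M]
    [Module (ExtAlg K n) M] [IsScalarTower K (ExtAlg K n) M] [Module.Finite K M]
    {𝓜 : ℤ → Submodule K M} (h𝓜 : IsGraded (n := n) 𝓜) (hs : ⨆ j, 𝓜 j = ⊤) :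
    Nonempty (GradedFreeResolution n 𝓜) := by
  obtain ⟨r, deg, φ, hφ, hsurj⟩ := exists_cover (n := n) hs
  obtain ⟨r', deg', d, hd, hex⟩ := exists_next h𝓜 hφ
  let seq : ℕ → FreeMap K n := fun i => Nat.rec ⟨r, deg, r', deg', d, hd⟩ (fun _ S => S.next) i
  exact ⟨{
    rank := fun i => (seq i).rank
    deg := fun i => (seq i).deg
    d := fun i => (seq i).d
    aug := φ
    d_homogeneous := fun i b => mem_freeGr.1 ((seq i).homogeneous b)
    aug_homogeneous := hφ
    aug_surjective := hsurj
    exact_zero := hex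
    exact_succ := fun i => (seq i).exact_next }⟩

/-! ### Homogeneous ideals -/

/-- `J` is generated by homogeneous elements, that is, closed under taking components. -/
def IsHomogeneous (J : TwoSidedIdeal (ExtAlg K n)) : Prop := ∀ x ∈ J, ∀ k, gproj K n k x ∈ J

theorem isHomogeneous_span {S : Set (ExtAlg K n)} (hS : ∀ x ∈ S, ∃ k, x ∈ gr K n k) :
    IsHomogeneous (TwoSidedIdeal.span S) := by
  intro x hx
  induction hx using TwoSidedIdeal.span_induction with
  | mem x hx =>
    intro k
    obtain ⟨j, hj⟩ := hS x hx
    by_cases h : k = j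
    · subst h
      rw [gproj_of_mem hj]
      exact TwoSidedIdeal.subset_span hx
    · rw [gproj_of_mem_ne hj h]
      exact zero_mem _
  | zero => exact fun k => by simp
  | add x y _ _ hx hy => exact fun k => by simpa using add_mem (hx k) (hy k)
  | neg x _ hx => exact fun k => by simpa using neg_mem (hx k)
  | left_absorb a x _ hx =>
    induction a using gr_induction with
    | mem j a ha =>
      intro k
      rw [gproj_mul_left ha]
      exact TwoSidedIdeal.mul_mem_left _ _ _ (hx _)
    | add a b ha hb => exact fun k => by simpa [add_mul] using add_mem (ha k) (hb k)
  | right_absorb a x _ hx =>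
    induction a using gr_induction with
    | mem j a ha =>
      intro k
      rw [gproj_mul_right ha]
      exact TwoSidedIdeal.mul_mem_right _ _ _ (hx _)
    | add a b ha hb => exact fun k => by simpa [mul_add] using add_mem (ha k) (hb k)

section

variable {J : TwoSidedIdeal (ExtAlg K n)}

theorem isGraded_idealGr : IsGraded (n := n) (idealGr J) := isGraded_comap isGraded_gr

theorem iSup_idealGr (hJ : IsHomogeneous J) : ⨆ j, idealGr J j = ⊤ := by
  refine eq_top_iff.2 fun x _ => ?_
  have hx : (x : ExtAlg K n) ∈ J := TwoSidedIdeal.mem_asIdeal.1 x.2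
  let y : ℤ → J.asIdeal := fun k => ⟨gproj K n k x, TwoSidedIdeal.mem_asIdeal.2 (hJ x hx k)⟩
  have : x = ∑ k ∈ Finset.Icc (0 : ℤ) n, y k := by
    refine Subtype.ext ?_
    rw [AddSubmonoidClass.coe_finsetSum]
    simpa using (sum_gproj (Finset.Icc (0 : ℤ) n) 0 (fun m hm => by simpa using hm) x.1).symm
  rw [this]
  exact Submodule.sum_mem _ fun k _ => Submodule.mem_iSup_of_mem k (gproj_mem k x.1)

theorem nonempty_resolution_ideal (hJ : IsHomogeneous J) :
    Nonempty (GradedFreeResolution n (idealGr J)) := by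
  have : Module.Finite K J.asIdeal :=
    inferInstanceAs (Module.Finite K (Submodule.restrictScalars K J.asIdeal))
  exact nonempty_gradedFreeResolution isGraded_idealGr (iSup_idealGr hJ)

theorem mk_eq_zero {x : ExtAlg K n} : Ideal.Quotient.mkₐ K J.asIdeal x = 0 ↔ x ∈ J := by
  rw [Ideal.Quotient.mkₐ_eq_mk, Ideal.Quotient.eq_zero_iff_mem, TwoSidedIdeal.mem_asIdeal]

theorem isGraded_quotGr (hJ : IsHomogeneous J) : IsGraded (n := n) (quotGr J) where
  smul_mem {i j a m} ha hm := by
    obtain ⟨x, hx, rfl⟩ := hm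
    exact ⟨a * x, mul_mem_gr ha hx, rfl⟩
  eq_zero s x hx h k hk := by
    choose y hy hyx using hx
    rw [← hyx]
    refine mk_eq_zero.2 ?_
    have h1 : ∑ k ∈ s, y k ∈ J := by
      rw [← mk_eq_zero, map_sum, ← h]
      exact Finset.sum_congr rfl fun k _ => hyx k
    have h2 := hJ _ h1 k
    rwa [map_sum, Finset.sum_eq_single_of_mem k hk
      (fun i _ hi => gproj_of_mem_ne (hy i) hi.symm), gproj_of_mem (hy k)] at h2

variable (J) in
/-- The projection `E^1 → E/J`. -/
def quotAug : (Fin 1 → ExtAlg K n) →ₗ[ExtAlg K n] Quot J :=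
  (Submodule.mkQ J.asIdeal) ∘ₗ LinearMap.proj 0

theorem quotAug_eq_zero {x : Fin 1 → ExtAlg K n} : quotAug J x = 0 ↔ x 0 ∈ J :=
  (Submodule.Quotient.mk_eq_zero _).trans TwoSidedIdeal.mem_asIdeal

/-- The resolution of `E/J` obtained from a resolution of `J`. -/
def GradedFreeResolution.splice (F : GradedFreeResolution n (idealGr J)) :
    GradedFreeResolution n (quotGr J) where
  rank
    | 0 => 1
    | i + 1 => F.rank i
  deg
    | 0 => 0
    | i + 1 => F.deg i
  d
    | 0 => LinearMap.pi fun _ => J.asIdeal.subtype ∘ₗ F.aug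
    | i + 1 => F.d i
  aug := quotAug J
  d_homogeneous
    | 0 => fun b _ => by
      have : (F.aug (Pi.single b 1) : ExtAlg K n) ∈ gr K n (F.deg 0 b) := F.aug_homogeneous b
      simpa using this
    | i + 1 => F.d_homogeneous i
  aug_homogeneous b := by
    rw [Subsingleton.elim b 0]
    exact ⟨1, by simpa using algebraMap_mem_gr (K := K) (n := n) 1, rfl⟩
  aug_surjective m := by
    obtain ⟨x, rfl⟩ := Submodule.Quotient.mk_surjective _ m
    exact ⟨fun _ => x, rfl⟩
  exact_zero x := by
    rw [quotAug_eq_zero]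
    constructor
    · intro hx
      obtain ⟨y, hy⟩ := F.aug_surjective ⟨x 0, TwoSidedIdeal.mem_asIdeal.2 hx⟩
      refine ⟨y, funext fun b => ?_⟩
      rw [Subsingleton.elim b 0]
      exact congrArg Subtype.val hy
    · rintro ⟨y, rfl⟩
      exact TwoSidedIdeal.mem_asIdeal.1 (F.aug y).2
  exact_succ
    | 0 => fun x => by
      rw [← F.exact_zero x]
      constructor
      · intro hx
        exact Subtype.ext (congrFun hx 0)
      · intro hx
        funext b
        exact congrArg Subtype.val hx
    | i + 1 => F.exact_succ i

/-- Only `i = 0` needs an argument: the new map `F_0 → E` has image `J`, which lies in the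
augmentation ideal, so it becomes zero after tensoring with `K` and imposes no cycle condition. -/
theorem GradedFreeResolution.finrank_tor_splice (F : GradedFreeResolution n (idealGr J))
    (hJ : ∀ x ∈ J, ExteriorAlgebra.algebraMapInv x = (0 : K)) (i : ℕ) (j : ℤ) :
    Module.finrank K (F.splice.Tor (i + 1) j) = Module.finrank K (F.Tor i j) := by
  cases i with
  | succ i => rfl
  | zero =>
    have h : F.splice.cycles 1 j = F.tensorGr 0 j := by
      refine inf_eq_left.2 fun u _ => ?_
      rw [LinearMap.mem_ker, tensorD_apply]
      funext b
      exact hJ _ (TwoSidedIdeal.mem_asIdeal.1 (F.aug _).2)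
    change Module.finrank K (F.splice.cycles 1 j ⧸ (F.boundaries 0 j).submoduleOf _) =
      Module.finrank K (F.tensorGr 0 j ⧸ (F.boundaries 0 j).submoduleOf (F.tensorGr 0 j))
    rw [h]
    rfl

theorem gradedBetti_eq {M : Type u} [AddCommGroup M] [Module K M]
    [Module (ExtAlg K n) M] [IsScalarTower K (ExtAlg K n) M]
    {𝓜 : ℤ → Submodule K M} (h𝓜 : IsGraded (n := n) 𝓜) (F : GradedFreeResolution n 𝓜)
    (i : ℕ) (j : ℤ) : gradedBetti n 𝓜 i j = Module.finrank K (F.Tor i j) := by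
  rw [gradedBetti, dif_pos ⟨F⟩, GradedFreeResolution.finrank_tor _ h𝓜, F.finrank_tor h𝓜]

theorem bettiIdeal_eq_finrank (hJ : IsHomogeneous J) (i : ℕ) (j : ℤ) :
    bettiIdeal J i j = Module.finrank K (CartanHomology (n := n) (idealGr J) i j) := by
  obtain ⟨F⟩ := nonempty_resolution_ideal hJ
  rw [bettiIdeal, gradedBetti_eq isGraded_idealGr F, F.finrank_tor isGraded_idealGr]

theorem bettiQuot_succ (hJ : IsHomogeneous J)
    (hJ0 : ∀ x ∈ J, ExteriorAlgebra.algebraMapInv x = (0 : K)) (i : ℕ) (j : ℤ) :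
    bettiQuot J (i + 1) j = bettiIdeal J i j := by
  obtain ⟨F⟩ := nonempty_resolution_ideal hJ
  rw [bettiQuot, bettiIdeal, gradedBetti_eq (isGraded_quotGr hJ) F.splice,
    gradedBetti_eq isGraded_idealGr F, F.finrank_tor_splice hJ0]

end

/-! ### Products with a fixed variable -/

theorem algebraMapInv_e_mul (c : Fin n) (x : ExtAlg K n) :
    ExteriorAlgebra.algebraMapInv (e K c * x) = (0 : K) := by
  rw [map_mul, e, algebraMapInv_linForm, zero_mul]

theorem contr_e (k l : Fin n) : contr k (e K l) = algebraMap K (ExtAlg K n) (if k = l then 1 else 0) := by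
  rw [e, contr_linForm, Pi.single_apply]

/-- Contracting with `c`, then with `k`, reads off the coefficient of `e_c ∧ e_k`. -/
theorem eq_zero_of_e_mul_linForm {c k : Fin n} (hk : k ≠ c) {w : Fin n → K}
    (h : e K c * linForm w = 0) : w k = 0 := by
  have h1 := congrArg (fun x => ExteriorAlgebra.algebraMapInv (contr k (contr c x))) h
  simp only [contr_e_mul, if_true, if_neg hk, map_sub, map_zero, contr_linForm, zero_sub, map_neg,
    algebraMapInv_e_mul, algebraMapInv_algebraMap, neg_zero, sub_zero] at h1
  exact h1

/-- The coefficient of `e_c ∧ e_k ∧ e_l` is `w k l - w l k`; three contractions extract it. -/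
theorem apply_comm_of_e_mul_sum {c k l : Fin n} (hk : k ≠ c) (hl : l ≠ c)
    {w : Fin n → Fin n → K} (h : e K c * ∑ m, e K m * linForm (w m) = 0) : w k l = w l k := by
  have hs : ∀ p, contr p (∑ m, e K m * linForm (w m)) = linForm (w p) - ∑ m, w m p • e K m := by
    intro p
    simp only [map_sum, contr_e_mul, contr_linForm, Finset.sum_sub_distrib, Finset.sum_ite_eq,
      Finset.mem_univ, if_true]
    congr 1
    exact Finset.sum_congr rfl fun m _ => by rw [← Algebra.commutes, Algebra.smul_def]
  have h1 := congrArg (fun x => ExteriorAlgebra.algebraMapInv (contr l (contr k (contr c x)))) h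
  rw [contr_e_mul, if_pos rfl, map_sub, contr_e_mul, if_neg hk, zero_sub, sub_neg_eq_add, hs,
    map_add, contr_e_mul, if_neg hl, zero_sub, map_add, map_neg, algebraMapInv_e_mul, neg_zero,
    add_zero, map_sub, contr_linForm, map_sub, algebraMapInv_algebraMap, map_sum, map_sum] at h1
  simp only [map_smul, contr_e, algebraMapInv_algebraMap, smul_eq_mul, mul_ite, mul_one, mul_zero,
    Finset.sum_ite_eq, Finset.mem_univ, if_true, map_zero] at h1
  exact sub_eq_zero.1 h1

/-! ### The components of low degree of the ideal -/

theorem mem_exampleIdeal_of_e_mul (k : Fin 5) : e K 0 * e K k ∈ exampleIdeal K := by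
  fin_cases k
  · exact (linForm_mul_self (K := K) _).symm ▸ zero_mem _
  all_goals exact TwoSidedIdeal.subset_span (by simp)

theorem e_mul_linForm_mem_exampleIdeal (v : Fin 5 → K) : e K 0 * linForm v ∈ exampleIdeal K := by
  rw [linForm_eq_sum, Finset.mul_sum]
  refine sum_mem fun k _ => ?_
  rw [mul_smul_comm, Algebra.smul_def]
  exact TwoSidedIdeal.mul_mem_left _ _ _ (mem_exampleIdeal_of_e_mul k)

theorem isHomogeneous_exampleIdeal : IsHomogeneous (exampleIdeal K) := by
  refine isHomogeneous_span fun x hx => ?_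
  have h2 : ∀ k l : Fin 5, e K k * e K l ∈ gr K 5 2 := fun k l =>
    mul_mem_gr (e_mem_gr k) (e_mem_gr l)
  simp only [Set.mem_insert_iff, Set.mem_singleton_iff] at hx
  rcases hx with rfl | rfl | rfl | rfl | rfl
  iterate 4 exact ⟨2, h2 _ _⟩
  exact ⟨3, mul_mem_gr (h2 1 2) (e_mem_gr 3)⟩

/-- The vanishing below degree 2 is carried through the induction because multiplication by a
homogeneous element turns lower components into the one of degree 2. -/
theorem gproj_exampleIdeal {x : ExtAlg K 5} (hx : x ∈ exampleIdeal K) :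
    (∀ k < 2, gproj K 5 k x = 0) ∧ ∃ v, gproj K 5 2 x = e K 0 * linForm v := by
  have h2 : ∀ k l : Fin 5, e K k * e K l ∈ gr K 5 2 := fun k l =>
    mul_mem_gr (e_mem_gr k) (e_mem_gr l)
  have gen : ∀ k : Fin 5, (∀ j < 2, gproj K 5 j (e K 0 * e K k) = 0) ∧
      ∃ v, gproj K 5 2 (e K 0 * e K k) = e K 0 * linForm v := fun k =>
    ⟨fun j hj => gproj_of_mem_ne (h2 0 k) hj.ne, _, gproj_of_mem (h2 0 k)⟩
  induction hx using TwoSidedIdeal.span_induction with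
  | mem x hx =>
    simp only [Set.mem_insert_iff, Set.mem_singleton_iff] at hx
    rcases hx with rfl | rfl | rfl | rfl | rfl
    iterate 4 exact gen _
    have h3 : e K 1 * e K 2 * e K (3 : Fin 5) ∈ gr K 5 3 := mul_mem_gr (h2 1 2) (e_mem_gr 3)
    refine ⟨fun j hj => gproj_of_mem_ne h3 (by omega), 0, ?_⟩
    rw [gproj_of_mem_ne h3 (by omega)]
    simp [linForm]
  | zero => exact ⟨fun _ _ => map_zero _, 0, by simp [linForm]⟩
  | add x y _ _ hx hy =>
    obtain ⟨hx, v, hv⟩ := hx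
    obtain ⟨hy, w, hw⟩ := hy
    exact ⟨fun k hk => by rw [map_add, hx k hk, hy k hk, add_zero], v + w, by
      rw [map_add, hv, hw, ← mul_add, linForm, linForm, linForm, map_add]⟩
  | neg x _ hx =>
    obtain ⟨hx, v, hv⟩ := hx
    exact ⟨fun k hk => by rw [map_neg, hx k hk, neg_zero], -v, by
      rw [map_neg, hv, linForm, linForm, map_neg, mul_neg]⟩
  | left_absorb a x _ hx =>
    obtain ⟨hx, v, hv⟩ := hx
    induction a using gr_induction with
    | mem j a ha =>
      rcases lt_or_ge j 0 with hj | hj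
      · rw [gr_of_neg hj, Submodule.mem_bot] at ha
        exact ⟨fun _ _ => by simp [ha], 0, by simp [ha, linForm]⟩
      refine ⟨fun k hk => by rw [gproj_mul_left ha, hx _ (by omega), mul_zero], ?_⟩
      rw [gproj_mul_left ha]
      -- A scalar rescales `v`; a factor of positive degree needs a component of `x` below degree 2,
      -- which is zero.
      rcases hj.eq_or_lt with rfl | hj
      · obtain ⟨c, rfl⟩ := mem_gr_zero ha
        refine ⟨c • v, ?_⟩
        rw [sub_zero, hv, linForm, linForm, map_smul, mul_smul_comm, Algebra.smul_def]
      · exact ⟨0, by rw [hx _ (by omega)]; simp [linForm]⟩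
    | add a b ha hb =>
      obtain ⟨ha, v, hv⟩ := ha
      obtain ⟨hb, w, hw⟩ := hb
      exact ⟨fun k hk => by rw [add_mul, map_add, ha k hk, hb k hk, add_zero], v + w, by
        rw [add_mul, map_add, hv, hw, ← mul_add, linForm, linForm, linForm, map_add]⟩
  | right_absorb a x _ hx =>
    obtain ⟨hx, v, hv⟩ := hx
    induction a using gr_induction with
    | mem j a ha =>
      rcases lt_or_ge j 0 with hj | hj
      · rw [gr_of_neg hj, Submodule.mem_bot] at ha
        exact ⟨fun _ _ => by simp [ha], 0, by simp [ha, linForm]⟩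
      refine ⟨fun k hk => by rw [gproj_mul_right ha, hx _ (by omega), zero_mul], ?_⟩
      rw [gproj_mul_right ha]
      rcases hj.eq_or_lt with rfl | hj
      · obtain ⟨c, rfl⟩ := mem_gr_zero ha
        refine ⟨c • v, ?_⟩
        rw [sub_zero, hv, linForm, linForm, map_smul, mul_smul_comm, Algebra.smul_def,
          Algebra.commutes]
      · exact ⟨0, by rw [hx _ (by omega)]; simp [linForm]⟩
    | add a b ha hb =>
      obtain ⟨ha, v, hv⟩ := ha
      obtain ⟨hb, w, hw⟩ := hb
      exact ⟨fun k hk => by rw [mul_add, map_add, ha k hk, hb k hk, add_zero], v + w, by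
        rw [mul_add, map_add, hv, hw, ← mul_add, linForm, linForm, linForm, map_add]⟩

theorem eq_zero_of_mem_exampleIdeal {x : ExtAlg K 5} (hx : x ∈ exampleIdeal K) {k : ℤ}
    (hk : k < 2) (h : x ∈ gr K 5 k) : x = 0 := by
  rw [← gproj_of_mem h, (gproj_exampleIdeal hx).1 k hk]

theorem exists_eq_of_mem_exampleIdeal {x : ExtAlg K 5} (hx : x ∈ exampleIdeal K)
    (h : x ∈ gr K 5 2) : ∃ v, x = e K 0 * linForm v := by
  obtain ⟨v, hv⟩ := (gproj_exampleIdeal hx).2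
  exact ⟨v, by rw [← hv, gproj_of_mem h]⟩

theorem algebraMapInv_of_mem_exampleIdeal {x : ExtAlg K 5} (hx : x ∈ exampleIdeal K) :
    ExteriorAlgebra.algebraMapInv x = (0 : K) := by
  rw [← sum_gproj (Finset.Icc (0 : ℤ) 5) 0 (fun m hm => by simpa using hm) x, map_sum]
  refine Finset.sum_eq_zero fun k _ => ?_
  by_cases hk : k - 0 = 0
  · rw [(gproj_exampleIdeal hx).1 _ (by omega), map_zero]
  · exact algebraMapInv_of_mem hk (gproj_mem _ _)

/-! ### The linear strand of the ideal -/

/-- The monomials of degree `i + 1` in five commuting variables, except for the power of the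
first variable. -/
abbrev StrandIndex (i : ℕ) : Type := {c : Fin 5 → ℕ // mdeg c = i + 1 ∧ ∃ k ≠ 0, c k ≠ 0}

theorem card_multiIndex (n d : ℕ) :
    Nat.card {c : Fin n → ℕ // mdeg c = d} = (n + d - 1).choose d := by
  rw [show {c : Fin n → ℕ // mdeg c = d} = {c : Fin n → ℕ // ∑ k, c k = d} from rfl,
    Nat.card_congr (Sym.equivNatSumOfFintype (Fin n) d).symm, Nat.card_eq_fintype_card,
    Sym.card_sym_eq_choose, Fintype.card_fin]

theorem finite_multiIndex (n d : ℕ) : {c : Fin n → ℕ | mdeg c = d}.Finite :=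
  Set.finite_coe_iff.1 (Finite.of_equiv _ (Sym.equivNatSumOfFintype (Fin n) d))

/-- The extra `1` is the excluded power of the first variable. -/
theorem card_strandIndex (i : ℕ) : Nat.card (StrandIndex i) + 1 = (i + 5).choose 4 := by
  have hs : {c : Fin 5 → ℕ | mdeg c = i + 1} = insert (Pi.single 0 (i + 1))
      {c : Fin 5 → ℕ | mdeg c = i + 1 ∧ ∃ k ≠ 0, c k ≠ 0} := by
    ext c
    simp only [Set.mem_ofPred_eq, Set.mem_insert_iff]
    constructor
    · intro h
      by_cases hc : ∃ k ≠ 0, c k ≠ 0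
      · exact Or.inr ⟨h, hc⟩
      · push Not at hc
        refine Or.inl (funext fun k => ?_)
        by_cases hk : k = 0
        · subst hk
          rw [Pi.single_eq_same, ← h, mdeg, Finset.sum_eq_single_of_mem 0 (Finset.mem_univ _)]
          exact fun l _ hl => hc l hl
        · rw [Pi.single_eq_of_ne hk, hc k hk]
    · rintro (rfl | h)
      · simp [mdeg]
      · exact h.1
  have h1 : {c : Fin 5 → ℕ | mdeg c = i + 1}.ncard = (i + 5).choose 4 := by
    refine (card_multiIndex 5 (i + 1)).trans ?_
    rw [show 5 + (i + 1) - 1 = i + 5 by omega]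
    exact Nat.choose_symm_of_eq_add (by omega)
  rw [← h1, hs, Set.ncard_insert_of_notMem _ ((finite_multiIndex 5 (i + 1)).subset fun c hc => hc.1)]
  · rfl
  · rintro ⟨-, k, hk, h⟩
    exact h (Pi.single_eq_of_ne hk _)

instance (i : ℕ) : Finite (StrandIndex i) :=
  (finite_multiIndex 5 (i + 1)).subset fun _ hc => hc.1

/-- The Cartan cycle `a ↦ e_1 ∧ ∑_k h(a + ε_k) e_k`. -/
def strandCycle (K : Type u) [Field K] (i : ℕ) :
    (StrandIndex i → K) →ₗ[K] ((Fin 5 → ℕ) → ExtAlg K 5) :=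
  (LinearMap.mulLeft K (e K 0)).compLeft (Fin 5 → ℕ) ∘ₗ bd K 5 _ ∘ₗ
    (Algebra.linearMap K (ExtAlg K 5)).compLeft (Fin 5 → ℕ) ∘ₗ
      Function.ExtendByZero.linearMap K (Subtype.val : StrandIndex i → Fin 5 → ℕ)

/-- Extension by zero of a function on `StrandIndex i`. -/
def strandExtend (i : ℕ) (h : StrandIndex i → K) : (Fin 5 → ℕ) → K :=
  Function.extend Subtype.val h 0

theorem strandExtend_coe (i : ℕ) (h : StrandIndex i → K) (c : StrandIndex i) :
    strandExtend i h c = h c :=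
  Subtype.val_injective.extend_apply h 0 c

theorem strandExtend_of_mdeg_ne {i : ℕ} (h : StrandIndex i → K) {c : Fin 5 → ℕ}
    (hc : mdeg c ≠ i + 1) : strandExtend i h c = 0 :=
  Function.extend_apply' _ _ _ (by
    rintro ⟨c, rfl⟩
    exact hc c.2.1)

theorem strandCycle_eq (i : ℕ) (h : StrandIndex i → K) :
    strandCycle K i h = fun a => e K (0 : Fin 5) *
      bd K 5 _ (fun a => algebraMap K (ExtAlg K 5) (strandExtend i h a)) a := rfl

theorem strandCycle_apply (i : ℕ) (h : StrandIndex i → K) (a : Fin 5 → ℕ) :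
    strandCycle K i h a = e K 0 * linForm fun k => strandExtend i h (a + Pi.single k 1) := by
  rw [linForm_eq_sum, strandCycle_eq]
  dsimp only
  rw [bd_apply]
  congr 1
  refine Finset.sum_congr rfl fun k _ => ?_
  rw [smul_eq_mul, Algebra.smul_def, Algebra.commutes]

theorem bd_e_mul (c : Fin n) (f : (Fin n → ℕ) → ExtAlg K n) :
    bd K n _ (fun a => e K c * f a) = fun a => -(e K c * bd K n _ f a) := by
  funext a
  rw [bd_apply, bd_apply, Finset.mul_sum, ← Finset.sum_neg_distrib]
  refine Finset.sum_congr rfl fun k _ => ?_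
  rw [smul_eq_mul, smul_eq_mul, ← mul_assoc, ← mul_assoc, e, e, linForm_mul_swap, neg_mul]

theorem bd_strandCycle (i : ℕ) (h : StrandIndex i → K) : bd K 5 _ (strandCycle K i h) = 0 := by
  rw [strandCycle_eq, bd_e_mul, bd_bd]
  funext a
  simp

theorem strandCycle_injective (i : ℕ) {h : StrandIndex i → K} (h0 : strandCycle K i h = 0) :
    h = 0 := by
  funext c
  obtain ⟨k, hk, hc⟩ := c.2.2
  have h1 := eq_zero_of_e_mul_linForm hk
    ((strandCycle_apply i h (c.1 - Pi.single k 1)).symm.trans (congrFun h0 _))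
  rwa [sub_single_add_single hc, strandExtend_coe] at h1

/-- A discrete Poincaré lemma: the cycle condition is the symmetry of mixed differences that makes
`v` come from a potential. The coordinate of `v` along `e_1` is irrelevant, as it disappears in `e_1
∧ v`. -/
theorem exists_strandCycle_eq {i : ℕ} {f : (Fin 5 → ℕ) → ExtAlg K 5}
    (hf : ∀ a, f a ∈ exampleIdeal K) (hf' : f ∈ chains (gr K 5) i (i + 2))
    (h0 : bd K 5 _ f = 0) : ∃ h, strandCycle K i h = f := by
  have hv : ∀ a, ∃ v, f a = e K (0 : Fin 5) * linForm v := by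
    intro a
    by_cases ha : mdeg a = i
    · refine exists_eq_of_mem_exampleIdeal (hf a) ?_
      have := (hf' a).1
      rwa [ha, add_sub_cancel_left] at this
    · exact ⟨0, by rw [(hf' a).2 ha, linForm, map_zero, mul_zero]⟩
  choose v hv using hv
  have comm : ∀ (a : Fin 5 → ℕ) {k l : Fin 5}, k ≠ 0 → l ≠ 0 →
      v (a + Pi.single k 1) l = v (a + Pi.single l 1) k := by
    intro a k l hk hl
    refine apply_comm_of_e_mul_sum (w := fun m => v (a + Pi.single m 1)) hk hl ?_
    have := congrFun h0 a
    rw [bd_apply] at this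
    rw [Finset.mul_sum, ← neg_eq_zero, ← Finset.sum_neg_distrib]
    refine Eq.trans (Finset.sum_congr rfl fun m _ => ?_) this
    rw [hv, smul_eq_mul, ← mul_assoc, ← mul_assoc, e, e, linForm_mul_swap, neg_mul, neg_neg]
  have indep : ∀ (c : Fin 5 → ℕ) {k l : Fin 5}, k ≠ 0 → l ≠ 0 → c k ≠ 0 → c l ≠ 0 →
      v (c - Pi.single k 1) k = v (c - Pi.single l 1) l := by
    intro c k l hk hl hck hcl
    by_cases hkl : k = l
    · rw [hkl]
    have h1 : (c - Pi.single k 1 : Fin 5 → ℕ) l ≠ 0 := by simpa [Ne.symm hkl] using hcl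
    obtain ⟨b, rfl⟩ : ∃ b : Fin 5 → ℕ, c = b + Pi.single l 1 + Pi.single k 1 :=
      ⟨c - Pi.single k 1 - Pi.single l 1, by
        rw [sub_single_add_single h1, sub_single_add_single hck]⟩
    rw [add_tsub_cancel_right, add_right_comm, add_tsub_cancel_right]
    exact comm b hl hk
  -- The potential at `c` is `v(c - ε_k)_k` for any admissible `k`; by `indep` the choice does not
  -- matter.
  refine ⟨fun c => v (c.1 - Pi.single c.2.2.choose 1) c.2.2.choose, ?_⟩
  funext a
  rw [strandCycle_apply]
  by_cases ha : mdeg a = i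
  · rw [hv a, linForm_eq_sum, linForm_eq_sum, Finset.mul_sum, Finset.mul_sum]
    refine Finset.sum_congr rfl fun k _ => ?_
    by_cases hk : k = 0
    · rw [hk, mul_smul_comm, mul_smul_comm, e, linForm_mul_self, smul_zero, smul_zero]
    · have hc : mdeg (a + Pi.single k 1) = i + 1 ∧ ∃ l ≠ 0, (a + Pi.single k 1 : Fin 5 → ℕ) l ≠ 0 :=
        ⟨by rw [mdeg_add_single, ha], k, hk, by simp⟩
      rw [strandExtend_coe i _ ⟨a + Pi.single k 1, hc⟩]
      dsimp only
      rw [indep _ hc.2.choose_spec.1 hk hc.2.choose_spec.2 (by simp), add_tsub_cancel_right]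
  · rw [(hf' a).2 ha]
    have : (fun k => strandExtend i (fun c : StrandIndex i =>
        v (c.1 - Pi.single c.2.2.choose 1) c.2.2.choose) (a + Pi.single k 1)) = 0 := by
      funext k
      exact strandExtend_of_mdeg_ne _ (by rw [mdeg_add_single]; omega)
    rw [this, linForm, map_zero, mul_zero]

theorem finrank_cartanHomology_exampleIdeal (i : ℕ) :
    Module.finrank K (CartanHomology (n := 5) (idealGr (exampleIdeal K)) i (i + 2)) =
      Nat.card (StrandIndex i) := by
  classical
  have : Fintype (StrandIndex i) := Fintype.ofFinite _
  let ι := (exampleIdeal K).asIdeal.subtype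
  have hinj : ∀ {f g : (Fin 5 → ℕ) → (exampleIdeal K).asIdeal}, ι ∘ f = ι ∘ g → f = g := fun h => by
    funext a
    exact Subtype.ext (congrFun h a)
  let P : (StrandIndex i → K) × ((Fin 5 → ℕ) → (exampleIdeal K).asIdeal) →ₗ[K]
      ((Fin 5 → ℕ) → ExtAlg K 5) :=
    strandCycle K i ∘ₗ LinearMap.fst K _ _ -
      (ι.restrictScalars K).compLeft (Fin 5 → ℕ) ∘ₗ LinearMap.snd K _ _
  have hP : ∀ w, w ∈ LinearMap.ker P ↔ strandCycle K i w.1 = ι ∘ w.2 := fun w => by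
    rw [LinearMap.mem_ker]
    exact sub_eq_zero (a := strandCycle K i w.1)
  -- Such a chain takes values in `J_1 = 0`, so there are no nonzero boundaries to divide by.
  have hB : ∀ g ∈ chains (n := 5) (idealGr (exampleIdeal K)) (i + 1) (i + 2), g = 0 := by
    intro g hg
    refine funext fun a => ?_
    by_cases ha : mdeg a = i + 1
    · refine Subtype.ext (eq_zero_of_mem_exampleIdeal (k := (i : ℤ) + 2 - mdeg a)
        (TwoSidedIdeal.mem_asIdeal.1 (g a).2) (by rw [ha]; push_cast; omega) (hg a).1)
    · exact (hg a).2 ha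
  have h1 := finrank_eq_of_relation (ZU := ⊤) (BU := ⊥)
    (ZV := chains (n := 5) (idealGr (exampleIdeal K)) i (i + 2) ⊓ LinearMap.ker (bd K 5 _))
    (BV := (chains (n := 5) (idealGr (exampleIdeal K)) (i + 1) (i + 2)).map (bd K 5 _))
    (LinearMap.ker P) (LinearMap.fst K _ _) (LinearMap.snd K _ _) ?_ ?_ ?_ ?_
  · rw [← h1, ((Submodule.quotEquivOfEqBot _ (by
      rw [Submodule.submoduleOf, Submodule.comap_bot, Submodule.ker_subtype])).trans
        Submodule.topEquiv).finrank_eq, Module.finrank_fintype_fun_eq_card, Nat.card_eq_fintype_card]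
  · intro h _
    have hmem : ∀ a, strandCycle K i h a ∈ (exampleIdeal K).asIdeal := fun a => by
      rw [TwoSidedIdeal.mem_asIdeal, strandCycle_apply]
      exact e_mul_linForm_mem_exampleIdeal _
    refine ⟨(h, fun a => ⟨_, hmem a⟩), (hP _).2 rfl, rfl, fun a => ?_, hinj ?_⟩
    · by_cases ha : mdeg a = i
      · refine ⟨?_, fun h => absurd ha h⟩
        rw [ha, add_sub_cancel_left]
        change strandCycle K i h a ∈ gr K 5 2
        rw [strandCycle_apply]
        exact mul_mem_gr (e_mem_gr 0) (linForm_mem_gr _)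
      · have h0 : strandCycle K i h a = 0 := by
          rw [strandCycle_apply]
          have : (fun k => strandExtend i h (a + Pi.single k 1)) = 0 := by
            funext k
            exact strandExtend_of_mdeg_ne _ (by rw [mdeg_add_single]; omega)
          rw [this, linForm, map_zero, mul_zero]
        have : (⟨_, hmem a⟩ : (exampleIdeal K).asIdeal) = 0 := Subtype.ext h0
        change (⟨_, hmem a⟩ : (exampleIdeal K).asIdeal) ∈ _ ∧
          (_ → (⟨_, hmem a⟩ : (exampleIdeal K).asIdeal) = 0)
        rw [this]
        exact ⟨zero_mem _, fun _ => rfl⟩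
    · change ι ∘ bd K 5 _ _ = 0
      rw [← bd_comp]
      exact bd_strandCycle i h
  · rintro f ⟨hf, hf0⟩
    obtain ⟨h, hh⟩ := exists_strandCycle_eq (f := ι ∘ f)
      (fun a => TwoSidedIdeal.mem_asIdeal.1 (f a).2) (comp_mem_chains (fun _ _ h => h) hf) (by
        rw [bd_comp, LinearMap.mem_ker.1 hf0]
        rfl)
    exact ⟨(h, f), (hP _).2 hh, rfl, trivial⟩
  · rintro ⟨h, f⟩ hw h0 -
    have hw' := (hP _).1 hw
    have h0' : h = 0 := h0
    rw [h0', map_zero] at hw'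
    have : f = 0 := hinj hw'.symm
    change f ∈ _
    rw [this]
    exact zero_mem _
  · rintro ⟨h, f⟩ hw ⟨g, hg, hgf⟩ -
    have hw' := (hP _).1 hw
    have hf : f = 0 := by
      rw [hB g hg, map_zero] at hgf
      exact hgf.symm
    rw [hf] at hw'
    exact strandCycle_injective i hw'

theorem bettiIdeal_exampleIdeal (i : ℕ) :
    bettiIdeal (exampleIdeal K) i (i + 2) + 1 = (i + 5).choose 4 := by
  rw [bettiIdeal_eq_finrank isHomogeneous_exampleIdeal, finrank_cartanHomology_exampleIdeal,
    card_strandIndex]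

/-! ### Monomials in the ideal -/

/-- The left factor `x` absorbs the common head of the lists, so that the induction passes through
`cons`. -/
theorem prod_mem_iff_of_perm (J : TwoSidedIdeal (ExtAlg K n)) {l l' : List (Fin n)}
    (h : l.Perm l') : ∀ x, x * (l.map (e K)).prod ∈ J ↔ x * (l'.map (e K)).prod ∈ J := by
  induction h with
  | nil => exact fun _ => Iff.rfl
  | cons a _ ih =>
    intro x
    simp only [List.map_cons, List.prod_cons, ← mul_assoc]
    exact ih _
  | swap a b l =>
    intro x
    simp only [List.map_cons, List.prod_cons, ← mul_assoc]
    rw [mul_assoc x, e, e, linForm_mul_swap, mul_neg, neg_mul, neg_mem_iff, ← mul_assoc]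
  | trans _ _ ih₁ ih₂ => exact fun x => (ih₁ x).trans (ih₂ x)

theorem prod_mem_of_perm {J : TwoSidedIdeal (ExtAlg K n)} {l l' : List (Fin n)}
    (h : l.Perm l') (h' : (l'.map (e K)).prod ∈ J) : (l.map (e K)).prod ∈ J := by
  simpa using (prod_mem_iff_of_perm J h 1).2 (by simpa using h')

theorem prod_eq_zero_of_perm {l l' : List (Fin n)} {a : Fin n} (h : l.Perm (a :: a :: l')) :
    (l.map (e K)).prod = 0 := by
  have := prod_mem_of_perm (K := K) (J := ⊥) h (by
    rw [List.map_cons, List.map_cons, List.prod_cons, List.prod_cons, ← mul_assoc, e,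
      linForm_mul_self, zero_mul]
    exact zero_mem _)
  simpa using this

theorem contr_prod_of_notMem {k : Fin n} {l : List (Fin n)} (hk : k ∉ l) :
    contr k (l.map (e K)).prod = 0 := by
  induction l with
  | nil => simp [contr_one]
  | cons a l ih =>
    rw [List.mem_cons, not_or] at hk
    rw [List.map_cons, List.prod_cons, contr_e_mul, if_neg hk.1, ih hk.2, mul_zero, sub_zero]

theorem prod_ne_zero_of_nodup {l : List (Fin n)} (h : l.Nodup) : (l.map (e K)).prod ≠ 0 := by
  induction l with
  | nil => simp
  | cons a l ih =>
    rw [List.nodup_cons] at h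
    intro h0
    apply ih h.2
    have := congrArg (contr a) h0
    rwa [List.map_cons, List.prod_cons, contr_e_mul, if_pos rfl, contr_prod_of_notMem h.1, mul_zero,
      sub_zero, map_zero] at this

theorem mono_ne_zero (F : Finset (Fin n)) : mono K F ≠ 0 :=
  prod_ne_zero_of_nodup (F.sort_nodup _)

/-- The endomorphism of `E` that sends the variables outside `F` to zero. -/
def restrictVars (K : Type*) [Field K] {n : ℕ} (F : Finset (Fin n)) : ExtAlg K n →ₐ[K] ExtAlg K n :=
  ExteriorAlgebra.map (LinearMap.pi fun k => if k ∈ F then LinearMap.proj k else 0)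

theorem restrictVars_e (F : Finset (Fin n)) (k : Fin n) :
    restrictVars K F (e K k) = if k ∈ F then e K k else 0 := by
  rw [restrictVars, e, linForm, ExteriorAlgebra.map_apply_ι]
  split_ifs with h
  · congr 1
    funext l
    by_cases hl : l = k
    · subst hl
      simp [h]
    · by_cases hF : l ∈ F <;> simp [hl, hF]
  · refine (congrArg _ ?_).trans (map_zero (ExteriorAlgebra.ι K))
    funext l
    by_cases hl : l = k
    · subst hl
      simp [h]
    · by_cases hF : l ∈ F <;> simp [hl, hF]

theorem restrictVars_mono (F : Finset (Fin n)) : restrictVars K F (mono K F) = mono K F := by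
  rw [mono, map_list_prod, List.map_map]
  congr 1
  refine List.map_congr_left fun k hk => ?_
  rw [Function.comp_apply, restrictVars_e, if_pos ((Finset.mem_sort _).1 hk)]

/-- The monomials `e_F` in the ideal: those divisible by one of the generators. -/
def IsMultiple (F : Finset (Fin 5)) : Prop := (0 ∈ F ∧ ∃ k ∈ F, k ≠ 0) ∨ (1 ∈ F ∧ 2 ∈ F ∧ 3 ∈ F)

instance : DecidablePred IsMultiple := fun F => by
  unfold IsMultiple
  infer_instance

theorem prod_mem_exampleIdeal {l : List (Fin 5)} (h : IsMultiple l.toFinset) :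
    (l.map (e K)).prod ∈ exampleIdeal K := by
  simp only [IsMultiple, List.mem_toFinset] at h
  rcases h with ⟨h0, k, hk, hk0⟩ | ⟨h1, h2, h3⟩
  · refine prod_mem_of_perm ((List.perm_cons_erase h0).trans
      ((List.perm_cons_erase ((List.mem_erase_of_ne hk0).2 hk)).cons 0)) ?_
    rw [List.map_cons, List.map_cons, List.prod_cons, List.prod_cons, ← mul_assoc]
    exact TwoSidedIdeal.mul_mem_right _ _ _ (mem_exampleIdeal_of_e_mul k)
  · have h2' := (List.mem_erase_of_ne (a := 2) (b := (1 : Fin 5)) (by decide)).2 h2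
    have h3' := (List.mem_erase_of_ne (a := 3) (b := (1 : Fin 5)) (by decide)).2 h3
    have h3'' := (List.mem_erase_of_ne (a := 3) (b := (2 : Fin 5)) (by decide)).2 h3'
    refine prod_mem_of_perm ((List.perm_cons_erase h1).trans
      (((List.perm_cons_erase h2').trans ((List.perm_cons_erase h3'').cons 2)).cons 1)) ?_
    simp only [List.map_cons, List.prod_cons, ← mul_assoc]
    exact TwoSidedIdeal.mul_mem_right _ _ _ (TwoSidedIdeal.subset_span (by simp))

/-- If no generator divides `e_F`, sending the variables outside `F` to zero kills every generator,
hence the ideal, but fixes `e_F ≠ 0`. -/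
theorem mono_mem_exampleIdeal {F : Finset (Fin 5)} :
    mono K F ∈ exampleIdeal K ↔ IsMultiple F := by
  refine ⟨fun h => ?_, fun h => prod_mem_exampleIdeal (by rwa [Finset.sort_toFinset])⟩
  by_contra hF
  simp only [IsMultiple, not_or, not_and, not_exists, not_not] at hF
  have hker : ∀ x ∈ exampleIdeal K, restrictVars K F x = 0 := by
    intro x hx
    induction hx using TwoSidedIdeal.span_induction with
    | mem x hx =>
      have h0 : ∀ k : Fin 5, k ≠ 0 → restrictVars K F (e K 0 * e K k) = 0 := by
        intro k hk
        rw [map_mul, restrictVars_e, restrictVars_e]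
        by_cases h0 : 0 ∈ F
        · rw [if_neg fun hkF => hk (hF.1 h0 k hkF), mul_zero]
        · rw [if_neg h0, zero_mul]
      simp only [Set.mem_insert_iff, Set.mem_singleton_iff] at hx
      rcases hx with rfl | rfl | rfl | rfl | rfl
      iterate 4 exact h0 _ (by decide)
      rw [map_mul, map_mul, restrictVars_e, restrictVars_e, restrictVars_e]
      by_cases h1 : 1 ∈ F
      · by_cases h2 : 2 ∈ F
        · rw [if_neg (hF.2 h1 h2), mul_zero]
        · rw [if_neg h2, mul_zero, zero_mul]
      · rw [if_neg h1, zero_mul, zero_mul]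
    | zero => exact map_zero _
    | add x y _ _ hx hy => rw [map_add, hx, hy, add_zero]
    | neg x _ hx => rw [map_neg, hx, neg_zero]
    | left_absorb a x _ hx => rw [map_mul, hx, mul_zero]
    | right_absorb a x _ hx => rw [map_mul, hx, zero_mul]
  exact mono_ne_zero F ((restrictVars_mono F).symm.trans (hker _ h))

theorem mono_toFinset {l : List (Fin n)} (hl : l.Pairwise (· < ·)) :
    mono K l.toFinset = (l.map (e K)).prod := by
  rw [mono, (List.toFinset_sort (· ≤ ·) (hl.imp ne_of_lt)).2 (hl.imp le_of_lt)]

theorem isMonomial_exampleIdeal : IsMonomial (exampleIdeal K) := by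
  refine ⟨{[0, 1].toFinset, [0, 2].toFinset, [0, 3].toFinset, [0, 4].toFinset,
    [1, 2, 3].toFinset}, ?_⟩
  simp only [Set.image_insert_eq, Set.image_singleton]
  rw [mono_toFinset (by decide), mono_toFinset (by decide), mono_toFinset (by decide),
    mono_toFinset (by decide), mono_toFinset (by decide)]
  simp [exampleIdeal, mul_assoc]

theorem isPure_exampleIdeal : IsPure (exampleIdeal K) := by
  refine ⟨(fun l : List (Fin 5) => l.map fun k => Pi.single k 1) ''
    {[0, 1], [0, 2], [0, 3], [0, 4], [1, 2, 3]}, ?_, ?_⟩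
  · rintro _ ⟨l, hl, rfl⟩ h
    rw [List.map_eq_nil_iff] at h
    subst h
    simp at hl
  · simp [Set.image_insert_eq, exampleIdeal, mul_assoc, e]

/-- In the first alternative the exchanged product has a repeated factor and is zero. -/
theorem isMultiple_insert_erase {F : Finset (Fin 5)} (hF : IsMultiple F) {i j : Fin 5} (hi : i ∈ F)
    (hj : j < i) : j ∈ F.erase i ∨ IsMultiple (insert j (F.erase i)) := by
  revert F i j
  decide

theorem isStronglyStable_exampleIdeal : IsStronglyStable (exampleIdeal K) := by
  refine ⟨isMonomial_exampleIdeal, fun F hF i hi j hj => ?_⟩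
  have heq : e K j * mono K (F.erase i) =
      ((j :: (F.erase i).sort (· ≤ ·)).map (e K)).prod := by
    rw [List.map_cons, List.prod_cons, mono]
  rw [heq]
  rcases isMultiple_insert_erase (mono_mem_exampleIdeal.1 hF) hi hj with h | h
  · rw [prod_eq_zero_of_perm ((List.perm_cons_erase ((Finset.mem_sort _).2 h)).cons j)]
    exact zero_mem _
  · refine prod_mem_exampleIdeal ?_
    rwa [List.toFinset_cons, Finset.sort_toFinset]

theorem linForm_mem_exampleIdeal {v : Fin 5 → K} (h : linForm v ∈ exampleIdeal K) : v = 0 :=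
  (ExteriorAlgebra.ι_eq_zero_iff _).1
    (eq_zero_of_mem_exampleIdeal h (by norm_num) (linForm_mem_gr v))

/-! ### The resonance variety -/

/-- The class of `β` is a cocycle; the coboundaries are the multiples of `α`, and no linear form is
lost in `E/J`. -/
theorem mem_resonance_one {J : TwoSidedIdeal (ExtAlg K n)}
    (hJ : ∀ v : Fin n → K, linForm v ∈ J → v = 0) {α β : Fin n → K}
    (h : linForm β * linForm α ∈ J) (hβ : ∀ c : K, β ≠ c • α) : α ∈ resonance J 1 := by
  have h1 : Ideal.Quotient.mkₐ K J.asIdeal (linForm β) ∈ cocycles J α 1 := by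
    refine ⟨⟨linForm β, by simpa using linForm_mem_gr β, rfl⟩, ?_⟩
    change Ideal.Quotient.mkₐ K J.asIdeal (linForm β) * Ideal.Quotient.mkₐ K J.asIdeal (linForm α) = 0
    rw [← map_mul, mk_eq_zero]
    exact h
  refine Submodule.Quotient.nontrivial_iff.2 fun htop => ?_
  have h2 : (⟨_, h1⟩ : cocycles J α 1) ∈ (coboundaries J α 1).submoduleOf (cocycles J α 1) := by
    rw [htop]
    trivial
  obtain ⟨_, ⟨x, hx, rfl⟩, h3⟩ := h2
  obtain ⟨c, rfl⟩ := mem_gr_zero (by simpa using hx)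
  change Ideal.Quotient.mkₐ K J.asIdeal _ * Ideal.Quotient.mkₐ K J.asIdeal (linForm α) =
    Ideal.Quotient.mkₐ K J.asIdeal (linForm β) at h3
  rw [← map_mul, ← Algebra.smul_def, ← sub_eq_zero, ← map_sub, mk_eq_zero, linForm, linForm,
    ← map_smul, ← map_sub] at h3
  exact hβ c (sub_eq_zero.1 (hJ _ h3)).symm

/-- The witness is `e_1` unless `α` is a multiple of `e_1`, and `e_2` in that case, which includes
`α = 0`. -/
theorem resonance_exampleIdeal : resonance (exampleIdeal K) 1 = Set.univ := by
  refine Set.eq_univ_of_forall fun α => ?_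
  by_cases h : ∃ k ≠ 0, α k ≠ 0
  · obtain ⟨k, hk, hα⟩ := h
    refine mem_resonance_one (fun _ => linForm_mem_exampleIdeal) (β := Pi.single 0 1)
      (e_mul_linForm_mem_exampleIdeal α) fun c hc => ?_
    have h1 := congrFun hc k
    rw [Pi.single_eq_of_ne hk, Pi.smul_apply, smul_eq_mul, eq_comm, mul_eq_zero] at h1
    have h2 := congrFun hc 0
    simp [h1.resolve_right hα] at h2
  · push Not at h
    refine mem_resonance_one (fun _ => linForm_mem_exampleIdeal) (β := Pi.single 1 1) ?_
      fun c hc => ?_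
    · rw [linForm_mul_swap, neg_mem_iff]
      have hα : α = α 0 • Pi.single 0 1 := by
        funext k
        by_cases hk : k = 0
        · simp [hk]
        · simp [hk, h k hk]
      rw [hα, linForm, map_smul, smul_mul_assoc, Algebra.smul_def]
      exact TwoSidedIdeal.mul_mem_left _ _ _ (mem_exampleIdeal_of_e_mul 1)
    · have h1 := congrFun hc 1
      simp [h 1 (by decide)] at h1

/-! ### The Zariski topology of the affine space -/

theorem exists_basicOpen_subset {U : Set (Fin n → K)} (hU : @IsOpen _ (zariski K n) U) {x : Fin n → K}
    (hx : x ∈ U) : ∃ f : MvPolynomial (Fin n) K, MvPolynomial.eval x f ≠ 0 ∧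
      ∀ y, MvPolynomial.eval y f ≠ 0 → y ∈ U := by
  induction hU with
  | basic U hU =>
    obtain ⟨f, rfl⟩ := hU
    exact ⟨f, hx, fun _ h => h⟩
  | univ => exact ⟨1, by simp, fun _ _ => trivial⟩
  | inter U V _ _ hU hV =>
    obtain ⟨f, hf, hfU⟩ := hU hx.1
    obtain ⟨g, hg, hgV⟩ := hV hx.2
    refine ⟨f * g, by rw [map_mul]; exact mul_ne_zero hf hg, fun y hy => ?_⟩
    rw [map_mul] at hy
    exact ⟨hfU y (left_ne_zero_of_mul hy), hgV y (right_ne_zero_of_mul hy)⟩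
  | sUnion S _ ih =>
    obtain ⟨U, hU, hxU⟩ := hx
    obtain ⟨f, hf, hfU⟩ := ih U hU hxU
    exact ⟨f, hf, fun y hy => ⟨U, hU, hfU y hy⟩⟩

variable (K n) in
-- Two nonempty open sets contain nonempty basic ones, given by `f` and `g`; over an infinite field
-- the nonzero polynomial `f * g` has a point where it does not vanish.
theorem zariskiIrreducible_univ [Infinite K] : ZariskiIrreducible (Set.univ : Set (Fin n → K)) := by
  refine ⟨Set.univ_nonempty, ?_⟩
  rintro U V hU hV ⟨x, -, hx⟩ ⟨y, -, hy⟩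
  obtain ⟨f, hf, hfU⟩ := exists_basicOpen_subset hU hx
  obtain ⟨g, hg, hgV⟩ := exists_basicOpen_subset hV hy
  have hne : f * g ≠ 0 := mul_ne_zero (fun h => hf (by simp [h])) (fun h => hg (by simp [h]))
  obtain ⟨z, hz⟩ : ∃ z, MvPolynomial.eval z (f * g) ≠ 0 := by
    by_contra! h
    exact hne (MvPolynomial.funext fun z => by simpa using h z)
  rw [map_mul] at hz
  exact ⟨z, trivial, hfU z (left_ne_zero_of_mul hz), hgV z (right_ne_zero_of_mul hz)⟩

variable (K n) in
theorem components_univ [Infinite K] : components (Set.univ : Set (Fin n → K)) = {Set.univ} := by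
  ext Z
  constructor
  · intro hZ
    exact Set.eq_univ_of_univ_subset
      (hZ.2 ⟨subset_rfl, zariskiIrreducible_univ K n⟩ (Set.subset_univ _))
  · rintro rfl
    exact ⟨⟨subset_rfl, zariskiIrreducible_univ K n⟩, fun _ _ _ => Set.subset_univ _⟩

variable (K n) in
theorem zdim_univ [Infinite K] : zdim (Set.univ : Set (Fin n → K)) = n := by
  have h : MvPolynomial.vanishingIdeal K (Set.univ : Set (Fin n → K)) = ⊥ := by
    refine (Submodule.eq_bot_iff _).2 fun f hf => MvPolynomial.funext fun z => ?_
    simpa [MvPolynomial.aeval_eq_eval] using hf z trivial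
  rw [zdim, h, ringKrullDim_eq_of_ringEquiv (RingEquiv.quotientBot _),
    MvPolynomial.ringKrullDim_of_isNoetherianRing, ringKrullDim_eq_zero_of_field, zero_add,
    Nat.card_eq_fintype_card, Fintype.card_fin]

theorem numComponents_exampleIdeal [Infinite K] (r : ℕ) :
    numComponents (exampleIdeal K) r = if r = 5 then 1 else 0 := by
  rw [numComponents, resonance_exampleIdeal, components_univ]
  split_ifs with hr
  · subst hr
    convert Set.ncard_singleton (Set.univ : Set (Fin 5 → K))
    ext Z
    refine ⟨fun h => h.1, ?_⟩
    rintro rfl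
    exact ⟨rfl, zdim_univ K 5⟩
  · convert Set.ncard_empty (Set (Fin 5 → K))
    ext Z
    refine ⟨?_, fun h => h.elim⟩
    rintro ⟨rfl, h⟩
    rw [zdim_univ] at h
    exact hr (by exact_mod_cast h.symm)

theorem conjecturedBetti_exampleIdeal [Infinite K] (i : ℕ) :
    conjecturedBetti (exampleIdeal K) (i + 1) = (i + 1) * (i + 5).choose (i + 2) := by
  rw [conjecturedBetti, Finset.sum_eq_single_of_mem 5 (by simp)]
  · rw [numComponents_exampleIdeal, if_pos rfl, one_mul, show 5 + (i + 1) - 1 = i + 5 by omega]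
  · intro r _ hr
    rw [numComponents_exampleIdeal, if_neg hr, zero_mul]

theorem not_propertyStar_exampleIdeal [Infinite K] : ¬ PropertyStar (exampleIdeal K) := by
  intro h
  -- The single component contains `e_2` and `e_3`, whose product is divisible by no generator.
  have h1 := h.2 Set.univ (by rw [resonance_exampleIdeal, components_univ]; rfl)
    (Pi.single 1 1) trivial (Pi.single 2 1) trivial
  have h2 : mono K [(1 : Fin 5), 2].toFinset ∈ exampleIdeal K := by
    rw [mono_toFinset (by decide)]
    simpa [e] using h1
  rw [mono_mem_exampleIdeal] at h2
  revert h2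
  decide

/-! ### Binomial coefficients -/

theorem sum_choose_add_one (i : ℕ) :
    (i + 1).choose 1 + (i + 2).choose 2 + (i + 3).choose 3 + (i + 4).choose 4 + 1 =
      (i + 5).choose 4 := by
  rw [Nat.choose_succ_succ (i + 4) 3, Nat.choose_succ_succ (i + 3) 2, Nat.choose_succ_succ (i + 2) 1,
    Nat.choose_succ_succ (i + 1) 0, Nat.choose_zero_right]
  ring

/-- Here `binom(i+5, i+2) = binom(i+5, 3)` and `4 binom(i+5, 4) = (i+2) binom(i+5, 3)`, where `i + 2
≤ 4(i + 1)`. -/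
theorem choose_four_le (i : ℕ) : (i + 5).choose 4 ≤ (i + 1) * (i + 5).choose (i + 2) := by
  have h := Nat.choose_succ_right_eq (i + 5) 3
  rw [show i + 5 - 3 = i + 2 by omega] at h
  rw [Nat.choose_symm_of_eq_add (show i + 5 = (i + 2) + 3 by omega)]
  nlinarith [Nat.zero_le ((i + 5).choose 3), Nat.zero_le (i * (i + 5).choose 3)]

/-! ### Failure of the conjectured formula -/

theorem bettiQuot_exampleIdeal_lt (i : ℕ) :
    bettiQuot (exampleIdeal K) (i + 1) (i + 2) < (i + 1) * (i + 5).choose (i + 2) := by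
  rw [bettiQuot_succ isHomogeneous_exampleIdeal fun _ => algebraMapInv_of_mem_exampleIdeal]
  have := bettiIdeal_exampleIdeal (K := K) i
  have := choose_four_le i
  omega

theorem not_linearStrandFormula_exampleIdeal [Infinite K] :
    ¬ LinearStrandFormula (exampleIdeal K) := by
  intro h
  obtain ⟨N, hN⟩ := Filter.eventually_atTop.1 h
  have h1 := hN (N + 1) (by omega)
  rw [conjecturedBetti_exampleIdeal] at h1
  have h2 := bettiQuot_exampleIdeal_lt (K := K) N
  rw [← h1] at h2
  push_cast at h2
  rw [add_assoc] at h2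
  exact lt_irrefl _ h2

theorem exampleIdeal_ne_bot : exampleIdeal K ≠ ⊥ := by
  intro h
  have h1 : mono K [(0 : Fin 5), 1].toFinset ∈ exampleIdeal K :=
    mono_mem_exampleIdeal.2 (by decide)
  rw [h] at h1
  exact mono_ne_zero _ h1

end ExtAlg
end

theorem mainTheorem8 (K : Type*) [Field K] :
    ExtAlg.IsStronglyStable (ExtAlg.exampleIdeal K) ∧
    ExtAlg.IsPure (ExtAlg.exampleIdeal K) ∧
    ExtAlg.resonance (ExtAlg.exampleIdeal K) 1 = Set.univ ∧
    (∀ i : ℕ,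
      ExtAlg.bettiIdeal (ExtAlg.exampleIdeal K) i (i + 2) =
        (i + 1).choose 1 + (i + 2).choose 2 + (i + 3).choose 3 + (i + 4).choose 4 ∧
      ExtAlg.bettiQuot (ExtAlg.exampleIdeal K) (i + 1) (i + 2) =
        ExtAlg.bettiIdeal (ExtAlg.exampleIdeal K) i (i + 2) ∧
      ExtAlg.bettiQuot (ExtAlg.exampleIdeal K) (i + 1) (i + 2) < (i + 1) * (i + 5).choose (i + 2)) ∧
    (Infinite K →
      ExtAlg.ZariskiIrreducible (ExtAlg.resonance (ExtAlg.exampleIdeal K) 1) ∧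
      ¬ ExtAlg.PropertyStar (ExtAlg.exampleIdeal K) ∧
      (∀ i : ℕ,
        ExtAlg.conjecturedBetti (ExtAlg.exampleIdeal K) (i + 1) =
          (i + 1) * (i + 5).choose (i + 2) ∧
        ExtAlg.bettiQuot (ExtAlg.exampleIdeal K) (i + 1) (i + 2) <
          ExtAlg.conjecturedBetti (ExtAlg.exampleIdeal K) (i + 1)) ∧
      ¬ ExtAlg.LinearStrandFormula (ExtAlg.exampleIdeal K) ∧
      ¬ ExtAlg.ConjectureBWithoutStar K) := by
  open ExtAlg in
  refine ⟨isStronglyStable_exampleIdeal, isPure_exampleIdeal, resonance_exampleIdeal, fun i =>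
    ⟨?_, bettiQuot_succ isHomogeneous_exampleIdeal (fun _ => algebraMapInv_of_mem_exampleIdeal) _ _,
      bettiQuot_exampleIdeal_lt i⟩, fun _ => ⟨?_, not_propertyStar_exampleIdeal, fun i =>
      ⟨conjecturedBetti_exampleIdeal i, ?_⟩, not_linearStrandFormula_exampleIdeal, fun h => ?_⟩⟩
  · exact Nat.add_right_cancel ((bettiIdeal_exampleIdeal i).trans (sum_choose_add_one i).symm)
  · rw [resonance_exampleIdeal]
    exact zariskiIrreducible_univ K 5
  · rw [conjecturedBetti_exampleIdeal]
    exact bettiQuot_exampleIdeal_lt i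
  · exact not_linearStrandFormula_exampleIdeal
      (h 5 _ exampleIdeal_ne_bot (fun _ => linForm_mem_exampleIdeal) isPure_exampleIdeal)
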